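/- Let $(\mathcal M,g_{ab})$ be a smooth 4-dimensional Lorentzian manifold of signature $(-,+,+,+)$ with smooth conformal factor $\Xi$, let $\lambda<0$, and let $\mathscr I\subset\mathcal M$ be an embedded timelike conformal boundary: a smooth hypersurface on which $\Xi=0$, with spacelike unit normal $n^a$ ($n_an^a=1$) and induced Lorentzian 3-metric $\ell_{ij}$. Let $D$ be the Levi-Civita derivative of $\ell$, $r_{ij}$ and $r$ its Ricci tensor and scalar, $l_{ij}=r_{ij}-\tfrac14 r\,\ell_{ij}$ its Schouten tensor and $y_{ijk}=D_il_{jk}-D_jl_{ik}$ its Cotton tensor; indices are raised with $\ell$. Let $T_{ab}$ be a smooth symmetric tracefree tensor on $\mathcal M$ and (with brackets normalised by $\tfrac12$) $$T_{abc}=\Xi\nabla_{[a}T_{b]c}-g_{c[a}T_{b]d}\nabla^d\Xi-3T_{c[a}\nabla_{b]}\Xi ,$$ and let $j_i$, $J_i$, $J_{ij}$ be the pull-backs to $\mathscr I$ of the tangential projections of $n^bT_{ab}$, $n^bn^cT_{abc}$, $n^cT_{abc}$ (free indices projected onto $\mathscr I$). The tracefree conformal constraints on $\mathscr I$ for fields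 $\Sigma$ (representing $n^a\nabla_a\Xi|_{\mathscr I}$), $s$, $K_{ij}=K_{(ij)}$, $L_i$, $L_{ij}=L_{(ij)}$, a symmetric tracefree $d_{ij}$, and $d_{kij}$ with $d_{kij}=-d_{kji}$, $d_{kij}+d_{ijk}+d_{jki}=0$, are (with $K=K_i{}^i$) $$\begin{aligned} &\Sigma K_{ij}=s\,\ell_{ij},\qquad D_i\Sigma=0,\qquad D_is=-L_i\Sigma,\qquad \lambda=-3\Sigma^2,\\ &D_iL_{jk}-D_jL_{ik}=-\Sigma d_{kij}-(K_{ik}L_j-K_{jk}L_i),\\ &D_iL_j-D_jL_i=K_i{}^kL_{jk}-K_j{}^kL_{ik},\\ &D^kd_{kij}=K^k{}_id_{jk}-K^k{}_jd_{ik}+J_{ij},\qquad D^jd_{ij}=K^{jk}d_{jik}+J_i,\\ &D_jK_{ki}-D_kK_{ji}=\ell_{ij}L_k-\ell_{ik}L_j,\\ &l_{ij}=L_{ij}+K\big(K_{ij}-\tfrac14K\ell_{ij}\big)-K_{ki}K_j{}^k+\tfrac14K_{kl}K^{kl}\ell_{ij}. \end{aligned}$$ Let $\varkappa$ be any smooth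 function on $\mathscr I$, let $d_{ij}$ be any smooth symmetric $\ell$-tracefree tensor field on $\mathscr I$, and suppose that $n^a\nabla_a\Xi=\sqrt{|\lambda|/3}$ on $\mathscr I$. Then, in every smooth chart of $\mathscr I$, the fields $$\Sigma=\sqrt{|\lambda|/3},\quad s=\Sigma\varkappa,\quad K_{ij}=\varkappa\ell_{ij},\quad L_i=-D_i\varkappa,\quad L_{ij}=l_{ij}-\tfrac12\varkappa^2\ell_{ij},\quad d_{kij}=-\Sigma^{-1}y_{ijk},$$ together with $d_{ij}$, solve the tracefree conformal constraints if and only if $$D^jd_{ij}=-\Sigma j_i .$$ -/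

import Mathlib

open scoped Manifold ContDiff

noncomputable section

namespace ConformalBoundary

/-- The coordinate space `ℝⁿ`, on which `n`-dimensional manifolds are modelled. -/
abbrev Coord (n : ℕ) : Type := EuclideanSpace ℝ (Fin n)

/-! ### Tensor calculus in coordinates

Covariant tensor fields of rank 1, 2, 3 on (an open part of) `ℝⁿ` are given by their components
`x ↦ (i ↦ A_i)`, `x ↦ (i, j ↦ B_ij)`, `x ↦ (i, j, k ↦ C_ijk)`. -/

section Coordinates

variable {n : ℕ}

/-- The partial derivative `∂_k f` at `x`. -/
def pd (k : Fin n) (f : Coord n → ℝ) (x : Coord n) : ℝ :=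
  fderiv ℝ f x (EuclideanSpace.single k 1)

/-- The components `g^{ij}` of the inverse metric. -/
def invMetric (g : Coord n → Fin n → Fin n → ℝ) (x : Coord n) (i j : Fin n) : ℝ :=
  (Matrix.of (g x))⁻¹ i j

/-- The Christoffel symbols
`Γ^k_{ij} = ½ g^{kl} (∂_i g_{jl} + ∂_j g_{il} - ∂_l g_{ij})` of the Levi-Civita connection,
written `christoffel g x k i j`. -/
def christoffel (g : Coord n → Fin n → Fin n → ℝ) (x : Coord n) (k i j : Fin n) : ℝ :=
  (1 / 2) * ∑ l, invMetric g x k l *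
    (pd i (fun y => g y j l) x + pd j (fun y => g y i l) x - pd l (fun y => g y i j) x)

/-- The covariant derivative `D_k A_i`. -/
def cov1 (g : Coord n → Fin n → Fin n → ℝ) (A : Coord n → Fin n → ℝ)
    (x : Coord n) (k i : Fin n) : ℝ :=
  pd k (fun y => A y i) x - ∑ l, christoffel g x l k i * A x l

/-- The covariant derivative `D_k B_{ij}`. -/
def cov2 (g : Coord n → Fin n → Fin n → ℝ) (B : Coord n → Fin n → Fin n → ℝ)
    (x : Coord n) (k i j : Fin n) : ℝ :=
  pd k (fun y => B y i j) x - ∑ l, christoffel g x l k i * B x l j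
    - ∑ l, christoffel g x l k j * B x i l

/-- The covariant derivative `D_m C_{ijk}`. -/
def cov3 (g : Coord n → Fin n → Fin n → ℝ) (C : Coord n → Fin n → Fin n → Fin n → ℝ)
    (x : Coord n) (m i j k : Fin n) : ℝ :=
  pd m (fun y => C y i j k) x - ∑ l, christoffel g x l m i * C x l j k
    - ∑ l, christoffel g x l m j * C x i l k - ∑ l, christoffel g x l m k * C x i j l

/-- The curvature tensor `R^a_{bcd}`, with the convention
`∇_c ∇_d u^a - ∇_d ∇_c u^a = R^a_{bcd} u^b`. -/
def riemann (g : Coord n → Fin n → Fin n → ℝ) (x : Coord n) (a b c d : Fin n) : ℝ :=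
  pd c (fun y => christoffel g y a d b) x - pd d (fun y => christoffel g y a c b) x
    + ∑ e, (christoffel g x a c e * christoffel g x e d b
      - christoffel g x a d e * christoffel g x e c b)

/-- The Ricci tensor `r_{bd} = R^a_{bad}`. -/
def ricci (g : Coord n → Fin n → Fin n → ℝ) (x : Coord n) (b d : Fin n) : ℝ :=
  ∑ a, riemann g x a b a d

/-- The trace `g^{ij} B_{ij}`. -/
def trace2 (g B : Coord n → Fin n → Fin n → ℝ) (x : Coord n) : ℝ :=
  ∑ i, ∑ j, invMetric g x i j * B x i j

/-- The Schouten tensor `l_{ij} = r_{ij} - ¼ r g_{ij}` of a 3-dimensional metric. -/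
def schouten3 (g : Coord 3 → Fin 3 → Fin 3 → ℝ) (x : Coord 3) (i j : Fin 3) : ℝ :=
  ricci g x i j - (1 / 4) * trace2 g (ricci g) x * g x i j

/-- The Cotton tensor `y_{ijk} = D_i l_{jk} - D_j l_{ik}` of a 3-dimensional metric. -/
def cotton3 (g : Coord 3 → Fin 3 → Fin 3 → ℝ) (x : Coord 3) (i j k : Fin 3) : ℝ :=
  cov2 g (schouten3 g) x i j k - cov2 g (schouten3 g) x j i k

/-- The divergence `D^j B_{ij}`. -/
def div2 (g B : Coord n → Fin n → Fin n → ℝ) (x : Coord n) (i : Fin n) : ℝ :=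
  ∑ j, ∑ m, invMetric g x j m * cov2 g B x m i j

/-- The tensor `T_{abc} = Ξ ∇_{[a} T_{b]c} - g_{c[a} T_{b]d} ∇^d Ξ - 3 T_{c[a} ∇_{b]} Ξ`
(the rescaled Cotton tensor of the conformal field equations), where square brackets denote
antisymmetrisation with the factor `½`. -/
def rescaledCotton (g : Coord n → Fin n → Fin n → ℝ) (Ξ : Coord n → ℝ)
    (T : Coord n → Fin n → Fin n → ℝ) (x : Coord n) (a b c : Fin n) : ℝ :=
  Ξ x * ((1 / 2) * (cov2 g T x a b c - cov2 g T x b a c))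
    - ∑ d, (1 / 2) * (g x c a * T x b d - g x c b * T x a d)
        * (∑ f, invMetric g x d f * pd f Ξ x)
    - 3 * ((1 / 2) * (T x c a * pd b Ξ x - T x c b * pd a Ξ x))

end Coordinates

/-! ### The conformal constraints on a conformal boundary -/

/-- The unknowns of the conformal constraints on a 3-dimensional conformal boundary, in a
coordinate chart: `Σ, s, K_{ij}, L_i, L_{ij}, d_{ij}, d_{kij}`. The last field is written
`dMag x k i j`. -/
structure BoundaryFields where
  sigma : Coord 3 → ℝ
  s : Coord 3 → ℝ
  K : Coord 3 → Fin 3 → Fin 3 → ℝ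
  L1 : Coord 3 → Fin 3 → ℝ
  L2 : Coord 3 → Fin 3 → Fin 3 → ℝ
  dEl : Coord 3 → Fin 3 → Fin 3 → ℝ
  dMag : Coord 3 → Fin 3 → Fin 3 → Fin 3 → ℝ

/-- The mixed components `B_i^k = ℓ^{km} B_{im}`. -/
def raise (ℓ B : Coord 3 → Fin 3 → Fin 3 → ℝ) (x : Coord 3) (i k : Fin 3) : ℝ :=
  ∑ m, invMetric ℓ x k m * B x i m

/-- The components `B^{ij} = ℓ^{ia} ℓ^{jb} B_{ab}`. -/
def raise2 (ℓ B : Coord 3 → Fin 3 → Fin 3 → ℝ) (x : Coord 3) (i j : Fin 3) : ℝ :=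
  ∑ a, ∑ b, invMetric ℓ x i a * invMetric ℓ x j b * B x a b

/-- `F` solves the tracefree conformal constraints (`Ω = 0`, `ε = 1`) on the coordinate domain
`U`, with cosmological constant `lam`, Lorentzian 3-metric `ℓ` and matter terms `J_i` (`J1`) and
`J_{ij}` (`J2`): the fields have the algebraic symmetries of the tensors they stand for, and the
ten constraint equations hold at every point of `U`. -/
structure SolvesConstraintsOn (lam : ℝ) (ℓ : Coord 3 → Fin 3 → Fin 3 → ℝ)
    (J1 : Coord 3 → Fin 3 → ℝ) (J2 : Coord 3 → Fin 3 → Fin 3 → ℝ)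
    (F : BoundaryFields) (U : Set (Coord 3)) : Prop where
  K_symm : ∀ x ∈ U, ∀ i j, F.K x i j = F.K x j i
  L2_symm : ∀ x ∈ U, ∀ i j, F.L2 x i j = F.L2 x j i
  dEl_symm : ∀ x ∈ U, ∀ i j, F.dEl x i j = F.dEl x j i
  dEl_trace : ∀ x ∈ U, trace2 ℓ F.dEl x = 0
  dMag_antisymm : ∀ x ∈ U, ∀ k i j, F.dMag x k i j = -F.dMag x k j i
  dMag_cyclic : ∀ x ∈ U, ∀ k i j, F.dMag x k i j + F.dMag x i j k + F.dMag x j k i = 0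
  /-- `Σ K_{ij} = s ℓ_{ij}` -/
  eq1 : ∀ x ∈ U, ∀ i j, F.sigma x * F.K x i j = F.s x * ℓ x i j
  /-- `D_i Σ = 0` -/
  eq2 : ∀ x ∈ U, ∀ i, pd i F.sigma x = 0
  /-- `D_i s = - L_i Σ` -/
  eq3 : ∀ x ∈ U, ∀ i, pd i F.s x = -(F.L1 x i * F.sigma x)
  /-- `D_i L_{jk} - D_j L_{ik} = - Σ d_{kij} - (K_{ik} L_j - K_{jk} L_i)` -/
  eq4 : ∀ x ∈ U, ∀ i j k, cov2 ℓ F.L2 x i j k - cov2 ℓ F.L2 x j i k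
    = -(F.sigma x * F.dMag x k i j) - (F.K x i k * F.L1 x j - F.K x j k * F.L1 x i)
  /-- `D_i L_j - D_j L_i = K_i^k L_{jk} - K_j^k L_{ik}` -/
  eq5 : ∀ x ∈ U, ∀ i j, cov1 ℓ F.L1 x i j - cov1 ℓ F.L1 x j i
    = (∑ k, raise ℓ F.K x i k * F.L2 x j k) - ∑ k, raise ℓ F.K x j k * F.L2 x i k
  /-- `D^k d_{kij} = K^k_i d_{jk} - K^k_j d_{ik} + J_{ij}` -/
  eq6 : ∀ x ∈ U, ∀ i j, (∑ k, ∑ m, invMetric ℓ x k m * cov3 ℓ F.dMag x m k i j)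
    = (∑ k, raise ℓ F.K x i k * F.dEl x j k) - (∑ k, raise ℓ F.K x j k * F.dEl x i k) + J2 x i j
  /-- `D^j d_{ij} = K^{jk} d_{jik} + J_i` -/
  eq7 : ∀ x ∈ U, ∀ i, div2 ℓ F.dEl x i
    = (∑ j, ∑ k, raise2 ℓ F.K x j k * F.dMag x j i k) + J1 x i
  /-- `λ = - 3 Σ²` -/
  eq8 : ∀ x ∈ U, lam = -3 * F.sigma x ^ 2
  /-- `D_j K_{ki} - D_k K_{ji} = ℓ_{ij} L_k - ℓ_{ik} L_j` -/
  eq9 : ∀ x ∈ U, ∀ i j k, cov2 ℓ F.K x j k i - cov2 ℓ F.K x k j i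
    = ℓ x i j * F.L1 x k - ℓ x i k * F.L1 x j
  /-- `l_{ij} = L_{ij} + K (K_{ij} - ¼ K ℓ_{ij}) - K_{ki} K_j^k + ¼ K_{kl} K^{kl} ℓ_{ij}` -/
  eq10 : ∀ x ∈ U, ∀ i j, schouten3 ℓ x i j
    = F.L2 x i j + trace2 ℓ F.K x * (F.K x i j - (1 / 4) * trace2 ℓ F.K x * ℓ x i j)
      - (∑ k, F.K x k i * raise ℓ F.K x j k)
      + (1 / 4) * (∑ k, ∑ l, F.K x k l * raise2 ℓ F.K x k l) * ℓ x i j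

/-- The explicit fields with gauge function `κ` and electric part `d_{ij}`:
`Σ = √(|λ|/3)`, `s = Σ κ`, `K_{ij} = κ ℓ_{ij}`, `L_i = - D_i κ`, `L_{ij} = l_{ij} - ½ κ² ℓ_{ij}`,
`d_{kij} = - Σ⁻¹ y_{ijk}`. -/
def explicitFields (lam : ℝ) (ℓ : Coord 3 → Fin 3 → Fin 3 → ℝ) (κ : Coord 3 → ℝ)
    (d : Coord 3 → Fin 3 → Fin 3 → ℝ) : BoundaryFields where
  sigma := fun _ => √(|lam| / 3)
  s := fun x => √(|lam| / 3) * κ x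
  K := fun x i j => κ x * ℓ x i j
  L1 := fun x i => -pd i κ x
  L2 := fun x i j => schouten3 ℓ x i j - (1 / 2) * κ x ^ 2 * ℓ x i j
  dEl := d
  dMag := fun x k i j => -((√(|lam| / 3))⁻¹ * cotton3 ℓ x i j k)

/-! ### Tensor fields and Lorentzian metrics on manifolds -/

section Manifolds

/-- Fields of bilinear forms on the tangent spaces of an `n`-dimensional manifold. -/
abbrev Tensor2 (n : ℕ) (M : Type*) [TopologicalSpace M] [ChartedSpace (Coord n) M] : Type _ :=
  ∀ p : M, TangentSpace (𝓡 n) p →ₗ[ℝ] TangentSpace (𝓡 n) p →ₗ[ℝ] ℝ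

variable {n : ℕ} {M : Type*} [TopologicalSpace M] [ChartedSpace (Coord n) M]

/-- The coordinate vector `∂_i` of the chart `e` at the point with coordinates `x`. -/
def coordVec (e : OpenPartialHomeomorph M (Coord n)) (x : Coord n) (i : Fin n) :
    TangentSpace (𝓡 n) (e.symm x) :=
  mfderiv (𝓡 n) (𝓡 n) e.symm x (EuclideanSpace.single i (1 : ℝ) : Coord n)

/-- The components `B_{ij}` of `B` in the chart `e`. -/
def comp2 (e : OpenPartialHomeomorph M (Coord n)) (B : Tensor2 n M) (x : Coord n)
    (i j : Fin n) : ℝ :=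
  B (e.symm x) (coordVec e x i) (coordVec e x j)

/-- The component `v^a` of the tangent vector `v` at `p` in the chart `e`. -/
def vecComp (e : OpenPartialHomeomorph M (Coord n)) {p : M} (v : TangentSpace (𝓡 n) p)
    (a : Fin n) : ℝ :=
  (show Coord n from mfderiv (𝓡 n) (𝓡 n) e p v) a

/-- A field of bilinear forms is smooth if its components in all smooth charts are. -/
def SmoothTensor2 (B : Tensor2 n M) : Prop :=
  ∀ e ∈ IsManifold.maximalAtlas (𝓡 n) ∞ M, ∀ i j,
    ContDiffOn ℝ ∞ (fun x => comp2 e B x i j) e.target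

/-- Symmetry of a field of bilinear forms. -/
def SymmTensor2 (B : Tensor2 n M) : Prop :=
  ∀ (p : M) (u v : TangentSpace (𝓡 n) p), B p u v = B p v u

/-- `B` is tracefree with respect to the metric `g`: `g^{ij} B_{ij} = 0` in all smooth charts. -/
def TracefreeTensor2 (g B : Tensor2 n M) : Prop :=
  ∀ e ∈ IsManifold.maximalAtlas (𝓡 n) ∞ M, ∀ x ∈ e.target,
    trace2 (comp2 e g) (comp2 e B) x = 0

/-- A smooth Lorentzian metric: a smooth field of symmetric bilinear forms of signature
`(-,+,…,+)`. -/
structure IsLorentzianMetric (g : Tensor2 n M) : Prop where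
  smooth : SmoothTensor2 g
  symm : SymmTensor2 g
  signature : ∀ p : M, ∃ b : Module.Basis (Fin n) ℝ (TangentSpace (𝓡 n) p),
    ∀ i j, g p (b i) (b j) = if i = j then (if i.val = 0 then -1 else 1) else 0

/-- The value `T_{abc} u^a v^b w^c` at the point `q` of the tensor `rescaledCotton` of
`(g, Ξ, T)`, computed in the preferred chart around `q`. -/
def rescaledCottonAt (g : Tensor2 n M) (Ξ : M → ℝ) (T : Tensor2 n M) (q : M)
    (u v w : TangentSpace (𝓡 n) q) : ℝ :=
  let e := chartAt (Coord n) q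
  ∑ a, ∑ b, ∑ c, rescaledCotton (comp2 e g) (fun y => Ξ (e.symm y)) (comp2 e T) (e q) a b c
    * vecComp e u a * vecComp e v b * vecComp e w c

end Manifolds

/-! ### Timelike conformal boundaries -/

section Boundary

variable {M : Type*} [TopologicalSpace M] [ChartedSpace (Coord 4) M]
  {N : Type*} [TopologicalSpace N] [ChartedSpace (Coord 3) N]

/-- The pushed-forward coordinate vector `dι(∂_i)` of the chart `e` of `N`. -/
def pushVec (ι : N → M) (e : OpenPartialHomeomorph N (Coord 3)) (x : Coord 3) (i : Fin 3) :
    TangentSpace (𝓡 4) (ι (e.symm x)) :=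
  mfderiv (𝓡 3) (𝓡 4) ι (e.symm x) (coordVec e x i)

/-- `ι : N → M` embeds the 3-manifold `N` as a timelike conformal boundary of the 4-dimensional
spacetime `(M, g)` with conformal factor `Ξ`, with induced Lorentzian 3-metric `ℓ` and (spacelike)
unit normal `nu`. -/
structure IsTimelikeConformalBoundary (g : Tensor2 4 M) (Ξ : M → ℝ) (ι : N → M) (ℓ : Tensor2 3 N)
    (nu : ∀ p : N, TangentSpace (𝓡 4) (ι p)) : Prop where
  lorentz : IsLorentzianMetric g
  smooth_factor : ContMDiff (𝓡 4) 𝓘(ℝ, ℝ) ∞ Ξ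
  embedding : Manifold.IsSmoothEmbedding (𝓡 3) (𝓡 4) ∞ ι
  factor_zero : ∀ p, Ξ (ι p) = 0
  lorentz_induced : IsLorentzianMetric ℓ
  induced : ∀ (p : N) (u v : TangentSpace (𝓡 3) p),
    ℓ p u v = g (ι p) (mfderiv (𝓡 3) (𝓡 4) ι p u) (mfderiv (𝓡 3) (𝓡 4) ι p v)
  normal_unit : ∀ p, g (ι p) (nu p) (nu p) = 1
  normal_orthogonal : ∀ (p : N) (u : TangentSpace (𝓡 3) p),
    g (ι p) (nu p) (mfderiv (𝓡 3) (𝓡 4) ι p u) = 0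

/-- The normal derivative `n^a ∇_a Ξ` along the hypersurface. -/
def normalDeriv (Ξ : M → ℝ) (ι : N → M) (nu : ∀ p : N, TangentSpace (𝓡 4) (ι p)) (p : N) : ℝ :=
  mfderiv (𝓡 4) 𝓘(ℝ, ℝ) Ξ (ι p) (nu p)

/-- The pull-back `j_i` of `n^b h_c^a T_{ab}`, in the chart `e` of `N`. -/
def jField (T : Tensor2 4 M) (ι : N → M) (nu : ∀ p : N, TangentSpace (𝓡 4) (ι p))
    (e : OpenPartialHomeomorph N (Coord 3)) (x : Coord 3) (i : Fin 3) : ℝ :=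
  T (ι (e.symm x)) (pushVec ι e x i) (nu (e.symm x))

/-- The pull-back `J_i` of `n^b n^c h_d^a T_{abc}`, in the chart `e` of `N`. -/
def J1Field (g : Tensor2 4 M) (Ξ : M → ℝ) (T : Tensor2 4 M) (ι : N → M)
    (nu : ∀ p : N, TangentSpace (𝓡 4) (ι p))
    (e : OpenPartialHomeomorph N (Coord 3)) (x : Coord 3) (i : Fin 3) : ℝ :=
  rescaledCottonAt g Ξ T (ι (e.symm x)) (pushVec ι e x i) (nu (e.symm x)) (nu (e.symm x))

/-- The pull-back `J_{ij}` of `n^c h_d^a h_e^b T_{abc}`, in the chart `e` of `N`. -/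
def J2Field (g : Tensor2 4 M) (Ξ : M → ℝ) (T : Tensor2 4 M) (ι : N → M)
    (nu : ∀ p : N, TangentSpace (𝓡 4) (ι p))
    (e : OpenPartialHomeomorph N (Coord 3)) (x : Coord 3) (i j : Fin 3) : ℝ :=
  rescaledCottonAt g Ξ T (ι (e.symm x)) (pushVec ι e x i) (pushVec ι e x j) (nu (e.symm x))

end Boundary

end ConformalBoundary

end

/-!
For the explicit fields, every constraint except the one on `D^j d_{ij}` is an identity, and the
matter terms are `J_{ij} = 0` and `J_i = -Σ j_i`. The constraint on `D^j d_{ij}` is then the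
claim.

*The matter terms.* As `Ξ` vanishes on the boundary, so does its derivative in the tangential
directions; the tangential directions and the normal span the tangent space of `M`, hence the
gradient of `Ξ` is `Σ n^a` (`IsTimelikeConformalBoundary.gradient_factor`). At a point where
`Ξ = 0` the tensor `T_{abc}` is algebraic in `T_{ab}` and this gradient
(`sum_rescaledCotton_of_eq_zero`). Inserting `Σ n^a` gives both matter terms.

*The identities.* Most constraints follow from `D ℓ = 0`, from the symmetry of the Schouten tensor
and of Hessians, and from `ℓ^{ij} ℓ_{ij} = 3`. The two divergence constraints need more: the Cotton
tensor is tracefree (`IsMetricOn.trace_cotton3`) and divergence-free in its last index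
(`IsMetricOn.div_cotton3`). The first is the contracted Bianchi identity `D^j r_{ij} = ½ D_i r`.
For the second one commutes the derivatives in `D^k D_i l_{jk}`: the main term is
`D_i D^k l_{jk} = ¼ D_i D_j r`, symmetric in `i, j`, and the curvature terms are symmetric by the
pair symmetry of the curvature tensor and the symmetry of the Ricci tensor, so that nothing
survives in `D^k y_{ijk}`.

*The calculus.* Everything is done in coordinates. The Christoffel symbols are organised as matrices
`(Γ_k)^a_b = Γ^a_{kb}`, and the curvature as matrices
`R_{cd} = ∂_c Γ_d - ∂_d Γ_c + [Γ_c, Γ_d]`. Metric compatibility, the Ricci identity and the second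
Bianchi identity are then identities in a noncommutative ring. Traces are handled by
`IsMetricOn.pd_trace`: contraction with the metric commutes with covariant differentiation.
-/

noncomputable section

namespace ConformalBoundary

/-! ### Calculus of matrix-valued functions and the Levi-Civita connection in coordinates -/

section CoordinateCalculus

variable {n : ℕ} {U : Set (Coord n)}

theorem differentiableAt_of_smooth {f : Coord n → ℝ} (hU : IsOpen U) (hf : ContDiffOn ℝ ∞ f U)
    {x : Coord n} (hx : x ∈ U) : DifferentiableAt ℝ f x :=
  (hf.contDiffAt (hU.mem_nhds hx)).differentiableAt (by simp)

theorem contDiffOn_pd {f : Coord n → ℝ} (hU : IsOpen U) (hf : ContDiffOn ℝ ∞ f U) (k : Fin n) :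
    ContDiffOn ℝ ∞ (pd k f) U :=
  (hf.fderiv_of_isOpen hU (m := ∞) (by simp)).clm_apply contDiffOn_const

theorem pd_congr {f f' : Coord n → ℝ} (hU : IsOpen U) (h : ∀ y ∈ U, f y = f' y)
    {x : Coord n} (hx : x ∈ U) (k : Fin n) : pd k f x = pd k f' x := by
  have : f =ᶠ[nhds x] f' := Filter.eventually_of_mem (hU.mem_nhds hx) h
  simp only [pd, this.fderiv_eq]

theorem pd_comm {f : Coord n → ℝ} (hU : IsOpen U) (hf : ContDiffOn ℝ ∞ f U)
    {x : Coord n} (hx : x ∈ U) (i j : Fin n) : pd i (pd j f) x = pd j (pd i f) x := by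
  have hc : ContDiffAt ℝ ∞ f x := hf.contDiffAt (hU.mem_nhds hx)
  have hd : DifferentiableAt ℝ (fderiv ℝ f) x :=
    (hc.fderiv_right (m := ∞) (by simp)).differentiableAt (by simp)
  have hs : IsSymmSndFDerivAt ℝ f x := hc.isSymmSndFDerivAt (by simpa using ENat.LEInfty.out)
  have key : ∀ a b : Fin n, pd a (pd b f) x
      = fderiv ℝ (fderiv ℝ f) x (EuclideanSpace.single a 1) (EuclideanSpace.single b 1) := by
    intro a b
    have : HasFDerivAt (pd b f) _ x :=
      hd.hasFDerivAt.clm_apply (hasFDerivAt_const (EuclideanSpace.single b (1 : ℝ)) x)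
    simp [pd, this.fderiv]
  rw [key, key, hs.eq]

section Rules

variable {f f' : Coord n → ℝ} {x : Coord n} (k : Fin n)

theorem pd_const (c : ℝ) : pd k (fun _ => c) x = 0 := by simp [pd]

theorem pd_add (hf : DifferentiableAt ℝ f x) (hf' : DifferentiableAt ℝ f' x) :
    pd k (fun y => f y + f' y) x = pd k f x + pd k f' x := by
  simp [pd, fderiv_fun_add hf hf']

theorem pd_sub (hf : DifferentiableAt ℝ f x) (hf' : DifferentiableAt ℝ f' x) :
    pd k (fun y => f y - f' y) x = pd k f x - pd k f' x := by
  simp [pd, fderiv_fun_sub hf hf']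

theorem pd_neg : pd k (fun y => -f y) x = -pd k f x := by
  simp [pd, fderiv_fun_neg]

theorem pd_mul (hf : DifferentiableAt ℝ f x) (hf' : DifferentiableAt ℝ f' x) :
    pd k (fun y => f y * f' y) x = pd k f x * f' x + f x * pd k f' x := by
  simp [pd, fderiv_fun_mul hf hf']; ring

theorem pd_const_mul (c : ℝ) (hf : DifferentiableAt ℝ f x) :
    pd k (fun y => c * f y) x = c * pd k f x := by
  rw [pd_mul k (differentiableAt_const c) hf, pd_const]; ring

theorem pd_sum {ι : Type*} (s : Finset ι) {F : ι → Coord n → ℝ}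
    (hF : ∀ i ∈ s, DifferentiableAt ℝ (F i) x) :
    pd k (fun y => ∑ i ∈ s, F i y) x = ∑ i ∈ s, pd k (F i) x := by
  simp [pd, fderiv_fun_sum hF]

end Rules

/-- Matrix-valued functions, all of whose entries are smooth on `U`. -/
def SmoothMat (U : Set (Coord n)) (A : Coord n → Matrix (Fin n) (Fin n) ℝ) : Prop :=
  ∀ i j, ContDiffOn ℝ ∞ (fun x => A x i j) U

/-- The entrywise partial derivative `∂_k A` of a matrix-valued function. -/
def matPd (k : Fin n) (A : Coord n → Matrix (Fin n) (Fin n) ℝ) (x : Coord n) :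
    Matrix (Fin n) (Fin n) ℝ :=
  Matrix.of fun i j => pd k (fun y => A y i j) x

section MatrixRules

variable {A B : Coord n → Matrix (Fin n) (Fin n) ℝ} {x : Coord n}

theorem SmoothMat.differentiableAt (hA : SmoothMat U A) (hU : IsOpen U) (hx : x ∈ U)
    (i j : Fin n) : DifferentiableAt ℝ (fun y => A y i j) x :=
  differentiableAt_of_smooth hU (hA i j) hx

theorem SmoothMat.add (hA : SmoothMat U A) (hB : SmoothMat U B) :
    SmoothMat U (fun y => A y + B y) := fun i j => (hA i j).add (hB i j)

theorem SmoothMat.sub (hA : SmoothMat U A) (hB : SmoothMat U B) :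
    SmoothMat U (fun y => A y - B y) := fun i j => (hA i j).sub (hB i j)

theorem SmoothMat.mul (hA : SmoothMat U A) (hB : SmoothMat U B) :
    SmoothMat U (fun y => A y * B y) := fun i j => by
  simp only [Matrix.mul_apply]
  exact ContDiffOn.sum fun l _ => (hA i l).mul (hB l j)

theorem SmoothMat.transpose (hA : SmoothMat U A) : SmoothMat U (fun y => (A y).transpose) :=
  fun i j => hA j i

theorem SmoothMat.matPd (hA : SmoothMat U A) (hU : IsOpen U) (k : Fin n) :
    SmoothMat U (matPd k A) := fun i j => contDiffOn_pd hU (hA i j) k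

theorem matPd_congr (hU : IsOpen U) (h : ∀ y ∈ U, A y = B y) (hx : x ∈ U) (k : Fin n) :
    matPd k A x = matPd k B x := by
  ext i j
  exact pd_congr hU (fun y hy => by rw [h y hy]) hx k

theorem matPd_add (hU : IsOpen U) (hA : SmoothMat U A) (hB : SmoothMat U B) (hx : x ∈ U)
    (k : Fin n) : matPd k (fun y => A y + B y) x = matPd k A x + matPd k B x := by
  ext i j
  exact pd_add k (hA.differentiableAt hU hx i j) (hB.differentiableAt hU hx i j)

theorem matPd_sub (hU : IsOpen U) (hA : SmoothMat U A) (hB : SmoothMat U B) (hx : x ∈ U)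
    (k : Fin n) : matPd k (fun y => A y - B y) x = matPd k A x - matPd k B x := by
  ext i j
  exact pd_sub k (hA.differentiableAt hU hx i j) (hB.differentiableAt hU hx i j)

theorem matPd_mul (hU : IsOpen U) (hA : SmoothMat U A) (hB : SmoothMat U B) (hx : x ∈ U)
    (k : Fin n) : matPd k (fun y => A y * B y) x = matPd k A x * B x + A x * matPd k B x := by
  ext i j
  simp only [matPd, Matrix.mul_apply, Matrix.of_apply, Matrix.add_apply]
  rw [pd_sum (F := fun l y => A y i l * B y l j) k _ fun l _ =>
    (hA.differentiableAt hU hx i l).mul (hB.differentiableAt hU hx l j),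
    ← Finset.sum_add_distrib]
  exact Finset.sum_congr rfl fun l _ =>
    pd_mul k (hA.differentiableAt hU hx i l) (hB.differentiableAt hU hx l j)

theorem matPd_transpose (k : Fin n) :
    matPd k (fun y => (A y).transpose) x = (matPd k A x).transpose := rfl

theorem matPd_comm (hU : IsOpen U) (hA : SmoothMat U A) (hx : x ∈ U) (i j : Fin n) :
    matPd i (matPd j A) x = matPd j (matPd i A) x := by
  ext a b
  exact pd_comm hU (hA a b) hx i j

theorem contDiffOn_det {m : ℕ} {C : Coord n → Matrix (Fin m) (Fin m) ℝ}
    (hC : ∀ i j, ContDiffOn ℝ ∞ (fun x => C x i j) U) :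
    ContDiffOn ℝ ∞ (fun x => (C x).det) U := by
  simp only [Matrix.det_apply]
  exact ContDiffOn.sum fun σ _ => (contDiffOn_prod fun i _ => hC (σ i) i).const_smul _

theorem SmoothMat.inv (hA : SmoothMat U A) (hdet : ∀ x ∈ U, (A x).det ≠ 0) :
    SmoothMat U (fun x => (A x)⁻¹) := by
  intro i j
  simp only [Matrix.inv_def, Ring.inverse_eq_inv', Matrix.smul_apply, smul_eq_mul,
    Matrix.adjugate_apply]
  refine ((contDiffOn_det hA).inv hdet).mul (contDiffOn_det fun a b => ?_)
  by_cases h : a = j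
  · subst h; simpa [Matrix.updateRow_self] using contDiffOn_const
  · simpa [Matrix.updateRow_ne h] using hA a b

end MatrixRules

/-- `g` consists of the components of a smooth pseudo-Riemannian metric on the open set `U`: a
smooth field of symmetric matrices, with nowhere vanishing determinant. No signature is imposed. -/
structure IsMetricOn (g : Coord n → Fin n → Fin n → ℝ) (U : Set (Coord n)) : Prop where
  isOpen : IsOpen U
  smooth : ∀ i j, ContDiffOn ℝ ∞ (fun x => g x i j) U
  symm : ∀ x ∈ U, ∀ i j, g x i j = g x j i
  det_ne_zero : ∀ x ∈ U, (Matrix.of (g x)).det ≠ 0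

/-- The connection matrices `(Γ_k)^a_b = Γ^a_{kb}`. -/
def connMat (g : Coord n → Fin n → Fin n → ℝ) (k : Fin n) (x : Coord n) :
    Matrix (Fin n) (Fin n) ℝ :=
  Matrix.of fun a b => christoffel g x a k b

/-- The curvature matrices `(R_{cd})^a_b = R^a_{bcd}`. -/
def curvMat (g : Coord n → Fin n → Fin n → ℝ) (c d : Fin n) (x : Coord n) :
    Matrix (Fin n) (Fin n) ℝ :=
  Matrix.of fun a b => riemann g x a b c d

/-- The matrix of the covariant derivative `D_k B` of a covariant tensor of rank 2, viewed as a
matrix-valued function. -/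
def covMat (g : Coord n → Fin n → Fin n → ℝ) (k : Fin n) (B : Coord n → Matrix (Fin n) (Fin n) ℝ)
    (x : Coord n) : Matrix (Fin n) (Fin n) ℝ :=
  matPd k B x - (connMat g k x).transpose * B x - B x * connMat g k x

theorem cov2_eq_covMat (g B : Coord n → Fin n → Fin n → ℝ) (x : Coord n) (k i j : Fin n) :
    cov2 g B x k i j = covMat g k (fun y => Matrix.of (B y)) x i j := by
  simp only [cov2, covMat, Matrix.sub_apply, Matrix.mul_apply, connMat, matPd, Matrix.of_apply,
    Matrix.transpose_apply]
  congr 1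
  exact Finset.sum_congr rfl fun l _ => mul_comm _ _

theorem curvMat_eq (g : Coord n → Fin n → Fin n → ℝ) (c d : Fin n) (x : Coord n) :
    curvMat g c d x = matPd c (connMat g d) x - matPd d (connMat g c) x
      + connMat g c x * connMat g d x - connMat g d x * connMat g c x := by
  ext a b
  simp only [curvMat, riemann, matPd, connMat, Matrix.sub_apply, Matrix.add_apply,
    Matrix.mul_apply, Matrix.of_apply, Finset.sum_sub_distrib]
  ring

namespace IsMetricOn

variable {g : Coord n → Fin n → Fin n → ℝ} {x : Coord n} (hg : IsMetricOn g U)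
include hg

theorem smoothMat : SmoothMat U (fun x => Matrix.of (g x)) := hg.smooth

theorem smoothMat_inv : SmoothMat U (fun x => (Matrix.of (g x))⁻¹) :=
  hg.smoothMat.inv hg.det_ne_zero

theorem inv_mul (hx : x ∈ U) : (Matrix.of (g x))⁻¹ * Matrix.of (g x) = 1 :=
  Matrix.nonsing_inv_mul _ (isUnit_iff_ne_zero.2 (hg.det_ne_zero x hx))

theorem mul_inv (hx : x ∈ U) : Matrix.of (g x) * (Matrix.of (g x))⁻¹ = 1 :=
  Matrix.mul_nonsing_inv _ (isUnit_iff_ne_zero.2 (hg.det_ne_zero x hx))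

theorem transpose_eq (hx : x ∈ U) : (Matrix.of (g x)).transpose = Matrix.of (g x) := by
  ext i j; exact hg.symm x hx j i

theorem invMetric_symm (hx : x ∈ U) (i j : Fin n) : invMetric g x i j = invMetric g x j i := by
  have h : ((Matrix.of (g x))⁻¹).transpose = (Matrix.of (g x))⁻¹ := by
    rw [Matrix.transpose_nonsing_inv, hg.transpose_eq hx]
  exact (congrFun (congrFun h j) i)

theorem sum_invMetric_mul (hx : x ∈ U) (i j : Fin n) :
    ∑ k, invMetric g x i k * g x k j = if i = j then 1 else 0 := by
  have h := congrFun (congrFun (hg.inv_mul hx) i) j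
  rwa [Matrix.mul_apply, Matrix.one_apply] at h

theorem sum_mul_invMetric (hx : x ∈ U) (i j : Fin n) :
    ∑ k, g x i k * invMetric g x k j = if i = j then 1 else 0 := by
  have h := congrFun (congrFun (hg.mul_inv hx) i) j
  rwa [Matrix.mul_apply, Matrix.one_apply] at h

theorem christoffel_symm (hx : x ∈ U) (k i j : Fin n) :
    christoffel g x k i j = christoffel g x k j i := by
  unfold christoffel
  refine congrArg _ (Finset.sum_congr rfl fun l _ => ?_)
  rw [pd_congr hg.isOpen (fun y hy => hg.symm y hy i j) hx l]
  ring

theorem smoothMat_connMat (k : Fin n) : SmoothMat U (connMat g k) := by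
  intro a b
  refine contDiffOn_const.mul (ContDiffOn.sum fun l _ => (hg.smoothMat_inv a l).mul ?_)
  exact ((contDiffOn_pd hg.isOpen (hg.smooth _ _) _).add
    (contDiffOn_pd hg.isOpen (hg.smooth _ _) _)).sub (contDiffOn_pd hg.isOpen (hg.smooth _ _) _)

theorem smoothMat_covMat {B : Coord n → Matrix (Fin n) (Fin n) ℝ} (hB : SmoothMat U B)
    (k : Fin n) : SmoothMat U (covMat g k B) :=
  ((hB.matPd hg.isOpen k).sub ((hg.smoothMat_connMat k).transpose.mul hB)).sub
    (hB.mul (hg.smoothMat_connMat k))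

theorem smoothMat_curvMat (c d : Fin n) : SmoothMat U (curvMat g c d) := by
  have h := hg.smoothMat_connMat
  have := ((((h d).matPd hg.isOpen c).sub ((h c).matPd hg.isOpen d)).add ((h c).mul (h d))).sub
    ((h d).mul (h c))
  rwa [show curvMat g c d = _ from funext (curvMat_eq g c d)]

/-- Lowering the upper index of the Christoffel symbols. -/
theorem sum_christoffel_mul (hx : x ∈ U) (k i j : Fin n) :
    ∑ l, christoffel g x l k i * g x l j = (1 / 2) * (pd k (fun y => g y i j) x
      + pd i (fun y => g y k j) x - pd j (fun y => g y k i) x) := by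
  have h : ∀ l, christoffel g x l k i * g x l j = ∑ m, (invMetric g x m l * g x l j) *
      ((1 / 2) * (pd k (fun y => g y i m) x + pd i (fun y => g y k m) x
        - pd m (fun y => g y k i) x)) := by
    intro l
    rw [christoffel, Finset.mul_sum, Finset.sum_mul]
    refine Finset.sum_congr rfl fun m _ => ?_
    rw [hg.invMetric_symm hx m l]; ring
  simp_rw [h]
  rw [Finset.sum_comm]
  simp_rw [← Finset.sum_mul, hg.sum_invMetric_mul hx]
  simp

/-- Metric compatibility `∂_k g = Γ_kᵀ g + g Γ_k` of the Levi-Civita connection. -/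
theorem matPd_metric (hx : x ∈ U) (k : Fin n) :
    matPd k (fun y => Matrix.of (g y)) x
      = (connMat g k x).transpose * Matrix.of (g x) + Matrix.of (g x) * connMat g k x := by
  ext i j
  have h1 := hg.sum_christoffel_mul hx k i j
  have h2 := hg.sum_christoffel_mul hx k j i
  have h3 := pd_congr hg.isOpen (fun y hy => hg.symm y hy i j) hx k
  simp only [matPd, Matrix.add_apply, Matrix.mul_apply, connMat, Matrix.of_apply,
    Matrix.transpose_apply]
  have h4 : ∑ l, g x i l * christoffel g x l k j = ∑ l, christoffel g x l k j * g x l i :=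
    Finset.sum_congr rfl fun l _ => by rw [hg.symm x hx i l]; ring
  rw [h4, h1, h2]
  linarith

theorem cov2_metric (hx : x ∈ U) (k i j : Fin n) : cov2 g g x k i j = 0 := by
  rw [cov2_eq_covMat, covMat, hg.matPd_metric hx]
  simp

/-- Metric compatibility for the inverse metric, `∂_k g⁻¹ = -Γ_k g⁻¹ - g⁻¹ Γ_kᵀ`. -/
theorem matPd_inv (hx : x ∈ U) (k : Fin n) :
    matPd k (fun y => (Matrix.of (g y))⁻¹) x
      = -(connMat g k x * (Matrix.of (g x))⁻¹)
        - (Matrix.of (g x))⁻¹ * (connMat g k x).transpose := by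
  have h1 : matPd k (fun y => (Matrix.of (g y))⁻¹ * Matrix.of (g y)) x = 0 := by
    rw [matPd_congr hg.isOpen (B := fun _ => 1) (fun y hy => hg.inv_mul hy) hx]
    ext i j; exact pd_const k _
  rw [matPd_mul hg.isOpen hg.smoothMat_inv hg.smoothMat hx, hg.matPd_metric hx] at h1
  have h2 := congrArg (· * (Matrix.of (g x))⁻¹) h1
  simp only [Matrix.add_mul, Matrix.mul_assoc, Matrix.mul_add, hg.mul_inv hx, Matrix.mul_one,
    Matrix.zero_mul] at h2
  rw [← Matrix.mul_assoc _ (Matrix.of (g x)), hg.inv_mul hx, Matrix.one_mul] at h2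
  rw [eq_sub_iff_add_eq, ← sub_eq_zero, ← h2]
  abel

theorem sum_sum_invMetric_eq_trace (hx : x ∈ U) (C : Matrix (Fin n) (Fin n) ℝ) :
    ∑ i, ∑ j, invMetric g x i j * C i j = ((Matrix.of (g x))⁻¹ * C).trace := by
  simp only [Matrix.trace, Matrix.diag, Matrix.mul_apply]
  rw [Finset.sum_comm]
  exact Finset.sum_congr rfl fun j _ => Finset.sum_congr rfl fun i _ =>
    congrArg (· * C i j) (hg.invMetric_symm hx i j)

/-- Contraction with the metric commutes with covariant differentiation. -/
theorem pd_trace {C : Coord n → Matrix (Fin n) (Fin n) ℝ} (hC : SmoothMat U C) (hx : x ∈ U)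
    (k : Fin n) : pd k (fun y => ∑ i, ∑ j, invMetric g y i j * C y i j) x
      = ∑ i, ∑ j, invMetric g x i j * covMat g k C x i j := by
  have hM : SmoothMat U (fun y => (Matrix.of (g y))⁻¹ * C y) := hg.smoothMat_inv.mul hC
  have h1 : pd k (fun y => ∑ i, ((Matrix.of (g y))⁻¹ * C y) i i) x
      = (matPd k (fun y => (Matrix.of (g y))⁻¹ * C y) x).trace :=
    pd_sum k _ fun i _ => hM.differentiableAt hg.isOpen hx i i
  rw [pd_congr hg.isOpen (fun y hy => hg.sum_sum_invMetric_eq_trace hy (C y)) hx,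
    hg.sum_sum_invMetric_eq_trace hx]
  refine h1.trans ?_
  rw [matPd_mul hg.isOpen hg.smoothMat_inv hC hx, hg.matPd_inv hx, covMat]
  simp only [Matrix.sub_mul, Matrix.mul_sub, Matrix.neg_mul, Matrix.trace_add, Matrix.trace_sub,
    Matrix.trace_neg, Matrix.mul_assoc]
  -- `tr (Γ_k g⁻¹ C) = tr (g⁻¹ C Γ_k)`
  rw [Matrix.trace_mul_comm (connMat g k x), Matrix.mul_assoc]
  ring

end IsMetricOn

end CoordinateCalculus

/-! ### Curvature identities -/

section CurvatureIdentities

variable {n : ℕ} {U : Set (Coord n)}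

/-- The curvature tensor with lowered index, `R_{abcd} = g_{af} R^f_{bcd}`. -/
def lowRiem (g : Coord n → Fin n → Fin n → ℝ) (x : Coord n) (a b c d : Fin n) : ℝ :=
  ∑ f, g x a f * riemann g x f b c d

/-- The covariant derivative `D_e C_{abcd}`. -/
def cov4 (g : Coord n → Fin n → Fin n → ℝ) (C : Coord n → Fin n → Fin n → Fin n → Fin n → ℝ)
    (x : Coord n) (e a b c d : Fin n) : ℝ :=
  pd e (fun y => C y a b c d) x - ∑ l, christoffel g x l e a * C x l b c d
    - ∑ l, christoffel g x l e b * C x a l c d - ∑ l, christoffel g x l e c * C x a b l d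
    - ∑ l, christoffel g x l e d * C x a b c l

theorem riemann_antisymm (g : Coord n → Fin n → Fin n → ℝ) (x : Coord n) (a b c d : Fin n) :
    riemann g x a b c d = -riemann g x a b d c := by
  simp only [riemann, Finset.sum_sub_distrib]; ring

theorem lowRiem_antisymm_right (g : Coord n → Fin n → Fin n → ℝ) (x : Coord n)
    (a b c d : Fin n) : lowRiem g x a b c d = -lowRiem g x a b d c := by
  simp only [lowRiem, ← Finset.sum_neg_distrib]
  exact Finset.sum_congr rfl fun f _ => by rw [riemann_antisymm g x f b c d]; ring

theorem cov4_lowRiem_antisymm_right (g : Coord n → Fin n → Fin n → ℝ) (x : Coord n)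
    (e a b c d : Fin n) :
    cov4 g (lowRiem g) x e a b c d = -cov4 g (lowRiem g) x e a b d c := by
  simp only [cov4]
  simp_rw [lowRiem_antisymm_right g _ _ _ c d, lowRiem_antisymm_right g _ _ _ c _,
    lowRiem_antisymm_right g _ _ _ _ d, mul_neg, Finset.sum_neg_distrib, pd_neg]
  ring

theorem lowRiem_eq (g : Coord n → Fin n → Fin n → ℝ) (x : Coord n) (a b c d : Fin n) :
    lowRiem g x a b c d = (Matrix.of (g x) * curvMat g c d x) a b := by
  simp [lowRiem, Matrix.mul_apply, curvMat]

theorem covMat_apply (g : Coord n → Fin n → Fin n → ℝ) (k : Fin n)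
    (B : Coord n → Matrix (Fin n) (Fin n) ℝ) (x : Coord n) (i j : Fin n) :
    covMat g k B x i j = pd k (fun y => B y i j) x - ∑ l, christoffel g x l k i * B x l j
      - ∑ l, christoffel g x l k j * B x i l :=
  (cov2_eq_covMat g B x k i j).symm

namespace IsMetricOn

variable {g : Coord n → Fin n → Fin n → ℝ} {x : Coord n} (hg : IsMetricOn g U)
include hg

/-- The Ricci identity for a covariant tensor of rank 2, without the (symmetric) term that comes
from the Christoffel symbols contracted with the derivative index. -/
theorem covMat_comm {B : Coord n → Matrix (Fin n) (Fin n) ℝ} (hB : SmoothMat U B) (hx : x ∈ U)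
    (m i : Fin n) : covMat g m (covMat g i B) x - covMat g i (covMat g m B) x
      = -((curvMat g m i x).transpose * B x) - B x * curvMat g m i x := by
  have h := hg.smoothMat_connMat
  have key : ∀ m i, matPd m (covMat g i B) x = matPd m (matPd i B) x
      - ((matPd m (connMat g i) x).transpose * B x + (connMat g i x).transpose * matPd m B x)
      - (matPd m B x * connMat g i x + B x * matPd m (connMat g i) x) := by
    intro m i
    have e1 := matPd_mul hg.isOpen (h i).transpose hB hx m
    have e2 := matPd_mul hg.isOpen hB (h i) hx m
    have s1 := (h i).transpose.mul hB
    have s2 := hB.mul (h i)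
    have s3 := hB.matPd hg.isOpen i
    rw [matPd_transpose] at e1
    rw [← e1, ← e2, ← matPd_sub hg.isOpen s3 s1 hx, ← matPd_sub hg.isOpen (s3.sub s1) s2 hx]
    rfl
  have def2 : ∀ m i, covMat g m (covMat g i B) x = matPd m (covMat g i B) x
      - (connMat g m x).transpose * covMat g i B x - covMat g i B x * connMat g m x :=
    fun _ _ => rfl
  rw [def2, def2, key, key, matPd_comm hg.isOpen hB hx m i, curvMat_eq]
  simp only [covMat, Matrix.transpose_sub, Matrix.transpose_add, Matrix.transpose_mul]
  noncomm_ring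

/-- The second Bianchi identity for the curvature matrices. -/
theorem second_bianchi (hx : x ∈ U) (e c d : Fin n) :
    (matPd e (curvMat g c d) x + connMat g e x * curvMat g c d x
        - curvMat g c d x * connMat g e x)
      + (matPd c (curvMat g d e) x + connMat g c x * curvMat g d e x
        - curvMat g d e x * connMat g c x)
      + (matPd d (curvMat g e c) x + connMat g d x * curvMat g e c x
        - curvMat g e c x * connMat g d x) = 0 := by
  have h := hg.smoothMat_connMat
  have hU := hg.isOpen
  have key : ∀ e c d, matPd e (curvMat g c d) x = matPd e (matPd c (connMat g d)) x
      - matPd e (matPd d (connMat g c)) x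
      + (matPd e (connMat g c) x * connMat g d x + connMat g c x * matPd e (connMat g d) x)
      - (matPd e (connMat g d) x * connMat g c x + connMat g d x * matPd e (connMat g c) x) := by
    intro e c d
    have s1 := (h d).matPd hU c
    have s2 := (h c).matPd hU d
    have s3 := (h c).mul (h d)
    have s4 := (h d).mul (h c)
    rw [← matPd_mul hU (h c) (h d) hx, ← matPd_mul hU (h d) (h c) hx, ← matPd_sub hU s1 s2 hx,
      ← matPd_add hU (s1.sub s2) s3 hx, ← matPd_sub hU ((s1.sub s2).add s3) s4 hx]
    exact matPd_congr hU (fun y _ => curvMat_eq g c d y) hx e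
  rw [key, key, key, matPd_comm hU (h d) hx e c, matPd_comm hU (h c) hx e d,
    matPd_comm hU (h e) hx c d]
  simp only [curvMat_eq]
  noncomm_ring

theorem covMat_metric (hx : x ∈ U) (k : Fin n) : covMat g k (fun y => Matrix.of (g y)) x = 0 := by
  rw [covMat, hg.matPd_metric hx]; abel

theorem covMat_covMat_metric (hx : x ∈ U) (m k : Fin n) :
    covMat g m (covMat g k (fun y => Matrix.of (g y))) x = 0 := by
  have h : matPd m (covMat g k (fun y => Matrix.of (g y))) x = 0 := by
    rw [matPd_congr hg.isOpen (B := fun _ => 0) (fun y hy => hg.covMat_metric hy k) hx]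
    ext i j; exact pd_const m _
  rw [covMat, h, hg.covMat_metric hx]; simp

/-- Antisymmetry in the first pair: the Ricci identity applied to the parallel tensor `g`. -/
theorem lowRiem_antisymm_left (hx : x ∈ U) (a b c d : Fin n) :
    lowRiem g x a b c d = -lowRiem g x b a c d := by
  have h := hg.covMat_comm hg.smoothMat hx c d
  rw [hg.covMat_covMat_metric hx, hg.covMat_covMat_metric hx] at h
  have h' := congrFun (congrFun h a) b
  have e : ((curvMat g c d x).transpose * Matrix.of (g x)) a b = lowRiem g x b a c d := by
    rw [lowRiem_eq, ← hg.transpose_eq hx, ← Matrix.transpose_mul, hg.transpose_eq hx]; rfl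
  simp only [Matrix.sub_apply, Matrix.neg_apply, e, ← lowRiem_eq] at h'
  simp at h'
  linarith

theorem pd_christoffel_symm (hx : x ∈ U) (l k i j : Fin n) :
    pd l (fun y => christoffel g y k i j) x = pd l (fun y => christoffel g y k j i) x :=
  pd_congr hg.isOpen (fun _ hy => hg.christoffel_symm hy k i j) hx l

theorem first_bianchi (hx : x ∈ U) (a b c d : Fin n) :
    riemann g x a b c d + riemann g x a c d b + riemann g x a d b c = 0 := by
  simp only [riemann, Finset.sum_sub_distrib]
  rw [hg.pd_christoffel_symm hx c a d b, hg.pd_christoffel_symm hx d a c b,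
    hg.pd_christoffel_symm hx b a d c]
  simp_rw [hg.christoffel_symm hx _ d b, hg.christoffel_symm hx _ c b,
    hg.christoffel_symm hx _ d c]
  ring

theorem lowRiem_first_bianchi (hx : x ∈ U) (a b c d : Fin n) :
    lowRiem g x a b c d + lowRiem g x a c d b + lowRiem g x a d b c = 0 := by
  simp only [lowRiem, ← Finset.sum_add_distrib, ← mul_add, hg.first_bianchi hx, mul_zero,
    Finset.sum_const_zero]

/-- Pair symmetry, from the first Bianchi identities for the four cyclic permutations of
`a, b, c, d` and the antisymmetries. -/
theorem lowRiem_pair_symm (hx : x ∈ U) (a b c d : Fin n) :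
    lowRiem g x a b c d = lowRiem g x c d a b := by
  have b1 := hg.lowRiem_first_bianchi hx a b c d
  have b2 := hg.lowRiem_first_bianchi hx b c d a
  have b3 := hg.lowRiem_first_bianchi hx c d a b
  have b4 := hg.lowRiem_first_bianchi hx d a b c
  have l := hg.lowRiem_antisymm_left hx
  have r := lowRiem_antisymm_right g x
  linarith [l a b c d, l a c d b, l a d b c, l b c d a, l b d a c, l b a c d, l c d a b,
    l c a b d, l c b d a, l d a b c, l d b c a, l d c a b, r a b c d, r a c d b, r a d b c,
    r b c d a, r b d a c, r b a c d, r c d a b, r c a b d, r c b d a, r d a b c, r d b c a,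
    r d c a b]

theorem riemann_eq_sum_lowRiem (hx : x ∈ U) (a b c d : Fin n) :
    riemann g x a b c d = ∑ f, invMetric g x a f * lowRiem g x f b c d := by
  have : ((Matrix.of (g x))⁻¹ * (Matrix.of (g x) * curvMat g c d x)) a b
      = riemann g x a b c d := by
    rw [← Matrix.mul_assoc, hg.inv_mul hx, Matrix.one_mul]; rfl
  rw [← this, Matrix.mul_apply]
  exact Finset.sum_congr rfl fun f _ => by rw [lowRiem_eq]; rfl

theorem ricci_eq_sum_lowRiem (hx : x ∈ U) (b d : Fin n) :
    ricci g x b d = ∑ a, ∑ c, invMetric g x a c * lowRiem g x a b c d := by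
  simp only [ricci, hg.riemann_eq_sum_lowRiem hx]
  rw [Finset.sum_comm]
  exact Finset.sum_congr rfl fun a _ => Finset.sum_congr rfl fun c _ => by
    rw [hg.invMetric_symm hx]

theorem ricci_symm (hx : x ∈ U) (b d : Fin n) : ricci g x b d = ricci g x d b := by
  rw [hg.ricci_eq_sum_lowRiem hx, hg.ricci_eq_sum_lowRiem hx, Finset.sum_comm]
  refine Finset.sum_congr rfl fun a _ => Finset.sum_congr rfl fun c _ => ?_
  rw [hg.invMetric_symm hx, hg.lowRiem_pair_symm hx]

theorem smooth_lowRiem (a b c d : Fin n) : ContDiffOn ℝ ∞ (fun x => lowRiem g x a b c d) U :=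
  ContDiffOn.sum fun f _ => (hg.smooth a f).mul (hg.smoothMat_curvMat c d f b)

theorem smooth_ricci (b d : Fin n) : ContDiffOn ℝ ∞ (fun x => ricci g x b d) U :=
  ContDiffOn.sum fun a _ => hg.smoothMat_curvMat a d a b

theorem smooth_trace2 {B : Coord n → Fin n → Fin n → ℝ}
    (hB : ∀ i j, ContDiffOn ℝ ∞ (fun x => B x i j) U) : ContDiffOn ℝ ∞ (trace2 g B) U :=
  ContDiffOn.sum fun i _ => ContDiffOn.sum fun j _ => (hg.smoothMat_inv i j).mul (hB i j)

theorem cov4_lowRiem_antisymm_left (hx : x ∈ U) (e a b c d : Fin n) :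
    cov4 g (lowRiem g) x e a b c d = -cov4 g (lowRiem g) x e b a c d := by
  simp only [cov4]
  rw [pd_congr hg.isOpen (fun y hy => hg.lowRiem_antisymm_left hy a b c d) hx, pd_neg]
  simp_rw [hg.lowRiem_antisymm_left hx a, hg.lowRiem_antisymm_left hx _ b, mul_neg,
    Finset.sum_neg_distrib]
  ring

/-- As `g` is parallel, `D_e R_{abcd}` is obtained by lowering an index of the covariant derivative
of the curvature matrices. -/
theorem cov4_lowRiem_eq (hx : x ∈ U) (e a b c d : Fin n) :
    cov4 g (lowRiem g) x e a b c d
      = (Matrix.of (g x) * (matPd e (curvMat g c d) x + connMat g e x * curvMat g c d x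
          - curvMat g c d x * connMat g e x)) a b
        - ∑ l, christoffel g x l e c * lowRiem g x a b l d
        - ∑ l, christoffel g x l e d * lowRiem g x a b c l := by
  have h : covMat g e (fun y => Matrix.of (g y) * curvMat g c d y) x
      = Matrix.of (g x) * (matPd e (curvMat g c d) x + connMat g e x * curvMat g c d x
          - curvMat g c d x * connMat g e x) := by
    rw [covMat, matPd_mul hg.isOpen hg.smoothMat (hg.smoothMat_curvMat c d) hx,
      hg.matPd_metric hx]
    noncomm_ring
  rw [← h, covMat_apply]
  simp only [cov4, ← lowRiem_eq]

theorem cov4_second_bianchi (hx : x ∈ U) (e a b c d : Fin n) :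
    cov4 g (lowRiem g) x e a b c d + cov4 g (lowRiem g) x c a b d e
      + cov4 g (lowRiem g) x d a b e c = 0 := by
  have h := congrArg (fun A => (Matrix.of (g x) * A) a b) (hg.second_bianchi hx e c d)
  simp only [Matrix.mul_add, Matrix.mul_zero, Matrix.add_apply, Matrix.zero_apply] at h
  simp only [hg.cov4_lowRiem_eq hx]
  simp_rw [hg.christoffel_symm hx _ d e, hg.christoffel_symm hx _ c e,
    hg.christoffel_symm hx _ d c, lowRiem_antisymm_right g x a b _ c,
    lowRiem_antisymm_right g x a b _ d, lowRiem_antisymm_right g x a b _ e,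
    mul_neg, Finset.sum_neg_distrib]
  linarith

end IsMetricOn

end CurvatureIdentities

/-! ### Contracted Bianchi identities, the Schouten and Cotton tensors -/

section ContractedIdentities

variable {n : ℕ} {U : Set (Coord n)}

/-- Pulls the Christoffel terms of uncontracted indices out of a contraction with `h`. -/
theorem sum_sum_mul_sub_sum (h A : Fin n → Fin n → ℝ) (γ : Fin n → ℝ)
    (B : Fin n → Fin n → Fin n → ℝ) :
    ∑ i, ∑ j, h i j * (A i j - ∑ l, γ l * B l i j)
      = ∑ i, ∑ j, h i j * A i j - ∑ l, γ l * ∑ i, ∑ j, h i j * B l i j := by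
  simp only [mul_sub, Finset.sum_sub_distrib, Finset.mul_sum]
  congr 1
  calc _ = ∑ i, ∑ l, ∑ j, h i j * (γ l * B l i j) :=
        Finset.sum_congr rfl fun i _ => Finset.sum_comm
    _ = ∑ l, ∑ i, ∑ j, h i j * (γ l * B l i j) := Finset.sum_comm
    _ = _ := Finset.sum_congr rfl fun l _ => Finset.sum_congr rfl fun i _ =>
        Finset.sum_congr rfl fun j _ => mul_left_comm _ _ _

theorem sum_pairs_comm (F : Fin n → Fin n → Fin n → Fin n → ℝ) :
    ∑ b, ∑ e, ∑ a, ∑ c, F b e a c = ∑ a, ∑ c, ∑ b, ∑ e, F b e a c := by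
  simp_rw [← Finset.sum_product' Finset.univ Finset.univ]
  exact Finset.sum_comm

namespace IsMetricOn

variable {g : Coord n → Fin n → Fin n → ℝ} {x : Coord n} (hg : IsMetricOn g U)
include hg

theorem pd_trace2 {B : Coord n → Fin n → Fin n → ℝ}
    (hB : ∀ i j, ContDiffOn ℝ ∞ (fun x => B x i j) U) (hx : x ∈ U) (k : Fin n) :
    pd k (trace2 g B) x = ∑ i, ∑ j, invMetric g x i j * cov2 g B x k i j := by
  simp only [cov2_eq_covMat]
  exact hg.pd_trace (C := fun y => Matrix.of (B y)) hB hx k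

theorem smooth_cov2 {B : Coord n → Fin n → Fin n → ℝ}
    (hB : ∀ i j, ContDiffOn ℝ ∞ (fun x => B x i j) U) (k i j : Fin n) :
    ContDiffOn ℝ ∞ (fun x => cov2 g B x k i j) U := by
  simp only [cov2_eq_covMat]
  exact hg.smoothMat_covMat (B := fun y => Matrix.of (B y)) hB k i j

theorem cov2_symm {B : Coord n → Fin n → Fin n → ℝ}
    (hB : ∀ x ∈ U, ∀ i j, B x i j = B x j i) (hx : x ∈ U) (k i j : Fin n) :
    cov2 g B x k i j = cov2 g B x k j i := by
  simp only [cov2]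
  rw [pd_congr hg.isOpen (fun y hy => hB y hy i j) hx]
  simp_rw [hB x hx _ j, hB x hx i _]
  ring

theorem cov2_mul_metric {f : Coord n → ℝ} (hf : ContDiffOn ℝ ∞ f U) (hx : x ∈ U)
    (k i j : Fin n) : cov2 g (fun y i j => f y * g y i j) x k i j = pd k f x * g x i j := by
  have h := hg.cov2_metric hx k i j
  simp only [cov2] at h ⊢
  rw [pd_mul k (differentiableAt_of_smooth hg.isOpen hf hx)
    (differentiableAt_of_smooth hg.isOpen (hg.smooth i j) hx)]
  simp_rw [mul_left_comm _ (f x), ← Finset.mul_sum]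
  linear_combination f x * h

theorem cov2_sub {A B : Coord n → Fin n → Fin n → ℝ}
    (hA : ∀ i j, ContDiffOn ℝ ∞ (fun x => A x i j) U)
    (hB : ∀ i j, ContDiffOn ℝ ∞ (fun x => B x i j) U) (hx : x ∈ U) (k i j : Fin n) :
    cov2 g (fun y i j => A y i j - B y i j) x k i j = cov2 g A x k i j - cov2 g B x k i j := by
  simp only [cov2]
  rw [pd_sub k (differentiableAt_of_smooth hg.isOpen (hA i j) hx)
    (differentiableAt_of_smooth hg.isOpen (hB i j) hx)]
  simp only [mul_sub, Finset.sum_sub_distrib]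
  ring

/-- Covariant differentiation commutes with the contraction that defines the Ricci tensor. -/
theorem cov2_ricci (hx : x ∈ U) (e b d : Fin n) : cov2 g (ricci g) x e b d
    = ∑ a, ∑ c, invMetric g x a c * cov4 g (lowRiem g) x e a b c d := by
  have h1 : pd e (fun y => ricci g y b d) x = ∑ a, ∑ c, invMetric g x a c
      * covMat g e (fun y => Matrix.of fun a c => lowRiem g y a b c d) x a c := by
    rw [pd_congr hg.isOpen (fun y hy => hg.ricci_eq_sum_lowRiem hy b d) hx]
    exact hg.pd_trace (C := fun y => Matrix.of fun a c => lowRiem g y a b c d)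
      (fun a c => hg.smooth_lowRiem a b c d) hx e
  have h2 : ∀ a c, cov4 g (lowRiem g) x e a b c d
      = covMat g e (fun y => Matrix.of fun a c => lowRiem g y a b c d) x a c
        - ∑ l, christoffel g x l e b * lowRiem g x a l c d
        - ∑ l, christoffel g x l e d * lowRiem g x a b c l := by
    intro a c
    simp only [covMat_apply, cov4, Matrix.of_apply]
    ring
  simp_rw [h2]
  refine Eq.symm ((sum_sum_mul_sub_sum (invMetric g x) _ (fun l => christoffel g x l e d)
    fun l a c => lowRiem g x a b c l).trans ?_)
  rw [cov2, h1]
  simp only [hg.ricci_eq_sum_lowRiem hx]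
  exact congrArg (· - _) (sum_sum_mul_sub_sum (invMetric g x) _ (fun l => christoffel g x l e b)
    fun l a c => lowRiem g x a l c d)

/-- The contracted second Bianchi identity `D^b r_{bd} = ½ D_d r`. -/
theorem contracted_bianchi (hx : x ∈ U) (d : Fin n) :
    ∑ b, ∑ e, invMetric g x b e * cov2 g (ricci g) x e b d
      = (1 / 2) * pd d (trace2 g (ricci g)) x := by
  set h := invMetric g x with hh
  set E := cov4 g (lowRiem g) x with hE
  have hric : ∀ e b d, cov2 g (ricci g) x e b d = ∑ a, ∑ c, h a c * E e a b c d :=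
    hg.cov2_ricci hx
  -- `t1`, `t2`, `t3` are the contractions with `g^{be} g^{ac}` of the three terms of the second
  -- Bianchi identity, `D_e R_{abcd} + D_c R_{abde} + D_d R_{abec} = 0`
  have t1 : ∑ b, ∑ e, ∑ a, ∑ c, h b e * (h a c * E e a b c d)
      = ∑ b, ∑ e, h b e * cov2 g (ricci g) x e b d := by
    simp only [hric, Finset.mul_sum]
  have t2 : ∑ b, ∑ e, ∑ a, ∑ c, h b e * (h a c * E c a b d e)
      = ∑ b, ∑ e, h b e * cov2 g (ricci g) x e b d := by
    simp only [hric, Finset.mul_sum]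
    -- after the antisymmetries, the roles of the two contracted pairs are exchanged
    have : ∀ b e a c, h b e * (h a c * E c a b d e) = h a c * (h b e * E c b a e d) := by
      intro b e a c
      rw [hE, hg.cov4_lowRiem_antisymm_left hx c a b d e, cov4_lowRiem_antisymm_right g x c b a d e]
      ring
    simp_rw [this]
    exact sum_pairs_comm _
  have t3 : ∑ b, ∑ e, ∑ a, ∑ c, h b e * (h a c * E d a b e c)
      = -pd d (trace2 g (ricci g)) x := by
    rw [hg.pd_trace2 hg.smooth_ricci hx]
    simp only [hric, Finset.mul_sum, ← Finset.sum_neg_distrib]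
    refine Finset.sum_congr rfl fun b _ => Finset.sum_congr rfl fun e _ =>
      Finset.sum_congr rfl fun a _ => Finset.sum_congr rfl fun c _ => ?_
    rw [hE, cov4_lowRiem_antisymm_right g x d a b e c]
    ring
  have t0 : ∑ b, ∑ e, ∑ a, ∑ c, (h b e * (h a c * E e a b c d)
      + h b e * (h a c * E c a b d e) + h b e * (h a c * E d a b e c)) = 0 := by
    refine Finset.sum_eq_zero fun b _ => Finset.sum_eq_zero fun e _ =>
      Finset.sum_eq_zero fun a _ => Finset.sum_eq_zero fun c _ => ?_
    have := hg.cov4_second_bianchi hx e a b c d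
    rw [← hE] at this
    linear_combination h b e * h a c * this
  simp only [Finset.sum_add_distrib] at t0
  rw [t1, t2, t3] at t0
  linarith

/-- The Ricci identity for a covariant tensor of rank 2. -/
theorem cov3_cov2_comm {B : Coord n → Fin n → Fin n → ℝ}
    (hB : ∀ i j, ContDiffOn ℝ ∞ (fun x => B x i j) U) (hx : x ∈ U) (m i j k : Fin n) :
    cov3 g (cov2 g B) x m i j k - cov3 g (cov2 g B) x i m j k
      = -(∑ l, riemann g x l j m i * B x l k) - ∑ l, riemann g x l k m i * B x j l := by
  have h := congrFun (congrFun
    (hg.covMat_comm (B := fun y => Matrix.of (B y)) hB hx m i) j) k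
  have key : ∀ m i, cov3 g (cov2 g B) x m i j k
      = covMat g m (covMat g i fun y => Matrix.of (B y)) x j k
        - ∑ l, christoffel g x l m i * cov2 g B x l j k := by
    intro m i
    rw [covMat_apply]
    simp only [cov3, ← cov2_eq_covMat]
    ring
  rw [Matrix.sub_apply] at h
  simp only [Matrix.sub_apply, Matrix.neg_apply, Matrix.mul_apply, Matrix.transpose_apply,
    curvMat, Matrix.of_apply] at h
  rw [key, key]
  simp_rw [hg.christoffel_symm hx _ i m]
  simp_rw [mul_comm (B x j _)] at h
  linarith

/-- `D_i` commutes with the contraction in the divergence `D^m B_{jm}`. -/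
theorem sum_invMetric_mul_cov3_cov2 {B : Coord n → Fin n → Fin n → ℝ}
    (hB : ∀ i j, ContDiffOn ℝ ∞ (fun x => B x i j) U) (hx : x ∈ U) (i j : Fin n) :
    ∑ k, ∑ m, invMetric g x k m * cov3 g (cov2 g B) x i m j k = cov1 g (div2 g B) x i j := by
  have h1 : pd i (fun y => div2 g B y j) x = ∑ k, ∑ m, invMetric g x k m
      * covMat g i (fun y => Matrix.of fun k m => cov2 g B y m j k) x k m :=
    hg.pd_trace (C := fun y => Matrix.of fun k m => cov2 g B y m j k)
      (fun k m => hg.smooth_cov2 hB m j k) hx i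
  have h2 : ∀ k m, cov3 g (cov2 g B) x i m j k
      = covMat g i (fun y => Matrix.of fun k m => cov2 g B y m j k) x k m
        - ∑ l, christoffel g x l i j * cov2 g B x m l k := by
    intro k m
    simp only [covMat_apply, cov3, Matrix.of_apply]
    ring
  simp_rw [h2]
  refine (sum_sum_mul_sub_sum (invMetric g x) _ (fun l => christoffel g x l i j)
    fun l k m => cov2 g B x m l k).trans ?_
  rw [cov1, h1]
  rfl

/-- The Hessian of a function is symmetric. -/
theorem cov1_pd_symm {f : Coord n → ℝ} (hf : ContDiffOn ℝ ∞ f U) (hx : x ∈ U) (i j : Fin n) :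
    cov1 g (fun y i => pd i f y) x i j = cov1 g (fun y i => pd i f y) x j i := by
  simp only [cov1]
  simp_rw [hg.christoffel_symm hx _ i j]
  rw [show pd i (fun y => pd j f y) x = _ from pd_comm hg.isOpen hf hx i j]

end IsMetricOn

end ContractedIdentities

section Dim3

namespace IsMetricOn

variable {U : Set (Coord 3)} {g : Coord 3 → Fin 3 → Fin 3 → ℝ} {x : Coord 3}
  (hg : IsMetricOn g U)
include hg

theorem schouten3_symm (hx : x ∈ U) (i j : Fin 3) : schouten3 g x i j = schouten3 g x j i := by
  rw [schouten3, schouten3, hg.ricci_symm hx, hg.symm x hx]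

theorem smooth_schouten3 (i j : Fin 3) : ContDiffOn ℝ ∞ (fun x => schouten3 g x i j) U :=
  (hg.smooth_ricci i j).sub
    ((contDiffOn_const.mul (hg.smooth_trace2 hg.smooth_ricci)).mul (hg.smooth i j))

theorem cov2_schouten3 (hx : x ∈ U) (k i j : Fin 3) : cov2 g (schouten3 g) x k i j
    = cov2 g (ricci g) x k i j - (1 / 4) * pd k (trace2 g (ricci g)) x * g x i j := by
  have hr := hg.smooth_trace2 hg.smooth_ricci
  have hr' : ContDiffOn ℝ ∞ (fun y => (1 / 4) * trace2 g (ricci g) y) U :=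
    contDiffOn_const.mul hr
  have h := hg.cov2_sub hg.smooth_ricci (fun i j => hr'.mul (hg.smooth i j)) hx k i j
  rw [hg.cov2_mul_metric hr' hx,
    pd_const_mul k _ (differentiableAt_of_smooth hg.isOpen hr hx)] at h
  exact h

/-- `D^j l_{ij} = ¼ D_i r`. -/
theorem div2_schouten3 (hx : x ∈ U) (i : Fin 3) :
    div2 g (schouten3 g) x i = (1 / 4) * pd i (trace2 g (ricci g)) x := by
  have h1 := hg.contracted_bianchi hx i
  have h2 : ∀ j m, invMetric g x j m * cov2 g (schouten3 g) x m i j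
      = invMetric g x j m * cov2 g (ricci g) x m j i
        - (1 / 4) * (pd m (trace2 g (ricci g)) x * (invMetric g x m j * g x j i)) := by
    intro j m
    rw [hg.cov2_schouten3 hx, hg.cov2_symm (fun y hy => hg.ricci_symm hy) hx m i j,
      hg.symm x hx i j, hg.invMetric_symm hx m j]
    ring
  simp only [div2, h2, Finset.sum_sub_distrib, h1]
  rw [Finset.sum_comm]
  simp_rw [← Finset.mul_sum, hg.sum_invMetric_mul hx]
  simp
  ring

/-- `ℓ^{ij} D_k l_{ij} = ¼ D_k r`, since the trace of the Schouten tensor is `r - ¾ r`; this is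
where the dimension 3 enters. -/
theorem sum_invMetric_mul_cov2_schouten3 (hx : x ∈ U) (k : Fin 3) :
    ∑ i, ∑ j, invMetric g x i j * cov2 g (schouten3 g) x k i j
      = (1 / 4) * pd k (trace2 g (ricci g)) x := by
  have h2 : ∀ i j, invMetric g x i j * cov2 g (schouten3 g) x k i j
      = invMetric g x i j * cov2 g (ricci g) x k i j
        - (1 / 4) * pd k (trace2 g (ricci g)) x * (invMetric g x i j * g x j i) := by
    intro i j
    rw [hg.cov2_schouten3 hx, hg.symm x hx i j]
    ring
  simp only [h2, Finset.sum_sub_distrib, ← Finset.mul_sum, hg.sum_invMetric_mul hx,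
    ← hg.pd_trace2 hg.smooth_ricci hx]
  simp
  ring

/-- The Cotton tensor is tracefree: `ℓ^{jk} y_{ikj} = 0`. -/
theorem trace_cotton3 (hx : x ∈ U) (i : Fin 3) :
    ∑ j, ∑ k, invMetric g x j k * cotton3 g x i k j = 0 := by
  have h1 := hg.sum_invMetric_mul_cov2_schouten3 hx i
  have h2 := hg.div2_schouten3 hx i
  simp only [div2] at h2
  simp only [cotton3, mul_sub, Finset.sum_sub_distrib]
  rw [h2, ← h1, sub_eq_zero]
  exact Finset.sum_congr rfl fun j _ => Finset.sum_congr rfl fun k _ => by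
    rw [hg.cov2_symm (fun y hy => hg.schouten3_symm hy) hx i k j]

theorem cotton3_cyclic (hx : x ∈ U) (i j k : Fin 3) :
    cotton3 g x i j k + cotton3 g x j k i + cotton3 g x k i j = 0 := by
  have h := fun k i j => hg.cov2_symm (fun y hy => hg.schouten3_symm hy) hx k i j
  simp only [cotton3]
  rw [h i j k, h j i k, h k j i]
  ring

/-- The curvature terms in the divergence of the Cotton tensor are symmetric. -/
theorem curvature_terms_symm (hx : x ∈ U) (i j : Fin 3) :
    ∑ k, ∑ m, invMetric g x k m * ((∑ l, riemann g x l j m i * schouten3 g x l k)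
        + ∑ l, riemann g x l k m i * schouten3 g x j l)
      = ∑ k, ∑ m, invMetric g x k m * ((∑ l, riemann g x l i m j * schouten3 g x l k)
        + ∑ l, riemann g x l k m j * schouten3 g x i l) := by
  set h := invMetric g x with hh
  set S := schouten3 g x with hS
  set R := lowRiem g x with hR
  set r := trace2 g (ricci g) x
  have hs : ∀ i j, h i j = h j i := hg.invMetric_symm hx
  have t1 : ∀ i j, ∑ k, ∑ m, h k m * ∑ l, riemann g x l j m i * S l k
      = ∑ k, ∑ m, ∑ l, ∑ p, h k m * h l p * S l k * R p j m i := by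
    intro i j
    simp only [hg.riemann_eq_sum_lowRiem hx, Finset.mul_sum, Finset.sum_mul]
    refine Finset.sum_congr rfl fun k _ => Finset.sum_congr rfl fun m _ =>
      Finset.sum_congr rfl fun l _ => Finset.sum_congr rfl fun p _ => by ring
  -- exchange the pairs of summation indices `(k, m)` and `(l, p)`, and use the pair symmetry of `R`
  have t1_symm : ∑ k, ∑ m, ∑ l, ∑ p, h k m * h l p * S l k * R p j m i
      = ∑ k, ∑ m, ∑ l, ∑ p, h k m * h l p * S l k * R p i m j := by
    rw [sum_pairs_comm]
    refine Finset.sum_congr rfl fun k _ => Finset.sum_congr rfl fun m _ =>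
      Finset.sum_congr rfl fun l _ => Finset.sum_congr rfl fun p _ => ?_
    rw [hS, hg.schouten3_symm hx k l, hR, hg.lowRiem_pair_symm hx m j p i]
    ring
  have t2 : ∀ i j, ∑ k, ∑ m, h k m * ∑ l, riemann g x l k m i * S j l
      = -∑ l, ∑ p, h l p * ricci g x j l * ricci g x p i + (1 / 4) * r * ricci g x j i := by
    intro i j
    have e1 : ∑ k, ∑ m, h k m * ∑ l, riemann g x l k m i * S j l
        = ∑ k, ∑ m, ∑ l, ∑ p, -(h l p * S j l * (h k m * R k p m i)) := by
      simp only [hg.riemann_eq_sum_lowRiem hx, Finset.mul_sum, Finset.sum_mul]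
      refine Finset.sum_congr rfl fun k _ => Finset.sum_congr rfl fun m _ =>
        Finset.sum_congr rfl fun l _ => Finset.sum_congr rfl fun p _ => ?_
      rw [hg.lowRiem_antisymm_left hx p k m i]
      ring
    have e2 : ∀ l p, h l p * S j l * ricci g x p i
        = h l p * ricci g x j l * ricci g x p i
          - (1 / 4) * r * (g x j l * h l p * ricci g x p i) := by
      intro l p
      rw [hS, schouten3]
      ring
    rw [e1, sum_pairs_comm]
    simp_rw [Finset.sum_neg_distrib, ← Finset.mul_sum, hR, hh,
      ← hg.ricci_eq_sum_lowRiem hx, ← hh, e2, Finset.sum_sub_distrib, ← Finset.mul_sum]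
    rw [Finset.sum_comm (f := fun l p => g x j l * h l p * ricci g x p i)]
    simp_rw [← Finset.sum_mul, hh, hg.sum_mul_invMetric hx]
    simp
    ring
  have t2_symm : ∑ l, ∑ p, h l p * ricci g x j l * ricci g x p i
      = ∑ l, ∑ p, h l p * ricci g x i l * ricci g x p j := by
    rw [Finset.sum_comm]
    refine Finset.sum_congr rfl fun p _ => Finset.sum_congr rfl fun l _ => ?_
    rw [hs l p, hg.ricci_symm hx j l, hg.ricci_symm hx p i]
    ring
  simp only [mul_add, Finset.sum_add_distrib]
  rw [t1, t1, t2, t2, t1_symm, t2_symm, hg.ricci_symm hx j i]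

/-- The Cotton tensor is divergence-free in its last index: `D^k y_{ijk} = 0`. -/
theorem div_cotton3 (hx : x ∈ U) (i j : Fin 3) :
    ∑ k, ∑ m, invMetric g x k m * cov3 g (cov2 g (schouten3 g)) x m i j k
      = ∑ k, ∑ m, invMetric g x k m * cov3 g (cov2 g (schouten3 g)) x m j i k := by
  have hr := hg.smooth_trace2 hg.smooth_ricci
  have hD : ∀ i j, cov1 g (div2 g (schouten3 g)) x i j
      = (1 / 4) * cov1 g (fun y i => pd i (trace2 g (ricci g)) y) x i j := by
    intro i j
    simp only [cov1, hg.div2_schouten3 hx]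
    rw [pd_congr hg.isOpen (fun y hy => hg.div2_schouten3 hy j) hx, pd_const_mul i _
      (differentiableAt_of_smooth hg.isOpen (contDiffOn_pd hg.isOpen hr j) hx)]
    simp_rw [mul_left_comm _ (1 / 4 : ℝ), ← Finset.mul_sum]
    ring
  have key : ∀ i j, ∑ k, ∑ m, invMetric g x k m * cov3 g (cov2 g (schouten3 g)) x m i j k
      = cov1 g (div2 g (schouten3 g)) x i j
        - ∑ k, ∑ m, invMetric g x k m * ((∑ l, riemann g x l j m i * schouten3 g x l k)
        + ∑ l, riemann g x l k m i * schouten3 g x j l) := by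
    intro i j
    rw [← hg.sum_invMetric_mul_cov3_cov2 hg.smooth_schouten3 hx, ← Finset.sum_sub_distrib]
    simp_rw [← Finset.sum_sub_distrib]
    refine Finset.sum_congr rfl fun k _ => Finset.sum_congr rfl fun m _ => ?_
    have := hg.cov3_cov2_comm hg.smooth_schouten3 hx m i j k
    linear_combination invMetric g x k m * this
  rw [key, key, hg.curvature_terms_symm hx, hD, hD, hg.cov1_pd_symm hr hx]

end IsMetricOn
end Dim3

/-! ### Components in charts and the rescaled Cotton tensor on the boundary -/

section Charts

variable {n : ℕ} {M : Type*} [TopologicalSpace M] [ChartedSpace (Coord n) M]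
  {e : OpenPartialHomeomorph M (Coord n)} {x : Coord n}

theorem mdifferentiable_of_mem_maximalAtlas (he : e ∈ IsManifold.maximalAtlas (𝓡 n) ∞ M) :
    e.MDifferentiable (𝓡 n) (𝓡 n) :=
  ⟨(contMDiffOn_of_mem_maximalAtlas he).mdifferentiableOn (by simp),
    (contMDiffOn_symm_of_mem_maximalAtlas he).mdifferentiableOn (by simp)⟩

theorem contDiffOn_comp_symm (he : e ∈ IsManifold.maximalAtlas (𝓡 n) ∞ M) {f : M → ℝ}
    (hf : ContMDiff (𝓡 n) 𝓘(ℝ, ℝ) ∞ f) : ContDiffOn ℝ ∞ (fun x => f (e.symm x)) e.target :=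
  (hf.comp_contMDiffOn (contMDiffOn_symm_of_mem_maximalAtlas he)).contDiffOn

theorem mfderiv_symm_eq_sum_coordVec (e : OpenPartialHomeomorph M (Coord n)) (x v : Coord n) :
    mfderiv (𝓡 n) (𝓡 n) e.symm x v = ∑ a, v a • coordVec e x a := by
  have hv : v = ∑ a, v a • (EuclideanSpace.single a (1 : ℝ) : Coord n) := by
    ext i; simp [Pi.single_apply]
  have h : mfderiv (𝓡 n) (𝓡 n) e.symm x
      (∑ a, v a • (EuclideanSpace.single a (1 : ℝ) : Coord n)) = ∑ a, v a • coordVec e x a :=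
    (map_sum (mfderiv (𝓡 n) (𝓡 n) e.symm x) _ _).trans
      (Finset.sum_congr rfl fun a _ => map_smul (mfderiv (𝓡 n) (𝓡 n) e.symm x) _ _)
  exact (congrArg (mfderiv (𝓡 n) (𝓡 n) e.symm x) hv).trans h

theorem eq_sum_vecComp (he : e ∈ IsManifold.maximalAtlas (𝓡 n) ∞ M) (hx : x ∈ e.target)
    (v : TangentSpace (𝓡 n) (e.symm x)) : v = ∑ a, vecComp e v a • coordVec e x a := by
  have hd := mdifferentiable_of_mem_maximalAtlas he
  apply hd.mfderiv_injective (e.map_target hx)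
  refine Eq.trans ?_ (congrArg _ (mfderiv_symm_eq_sum_coordVec e x
    (mfderiv (𝓡 n) (𝓡 n) e (e.symm x) v)))
  exact (DFunLike.congr_fun (hd.comp_symm_deriv hx)
    (mfderiv (𝓡 n) (𝓡 n) e (e.symm x) v)).symm

theorem sum_smul_coordVec_eq_zero (he : e ∈ IsManifold.maximalAtlas (𝓡 n) ∞ M)
    (hx : x ∈ e.target) {v : Fin n → ℝ} (hv : ∑ a, v a • coordVec e x a = 0) : v = 0 := by
  have hd := mdifferentiable_of_mem_maximalAtlas he
  have h := mfderiv_symm_eq_sum_coordVec e x (WithLp.toLp 2 v)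
  have h' : mfderiv (𝓡 n) (𝓡 n) e.symm x (WithLp.toLp 2 v : Coord n) = 0 := h.trans hv
  have h0 := hd.symm.mfderiv_injective hx (h'.trans (map_zero _).symm)
  funext i
  exact congrArg (fun w : Coord n => w i) h0

theorem sum_comp2_mul_vecComp (he : e ∈ IsManifold.maximalAtlas (𝓡 n) ∞ M) (hx : x ∈ e.target)
    (B : Tensor2 n M) (u v : TangentSpace (𝓡 n) (e.symm x)) :
    ∑ a, (∑ b, comp2 e B x a b * vecComp e v b) * vecComp e u a = B (e.symm x) u v := by
  conv_rhs => rw [eq_sum_vecComp he hx u, eq_sum_vecComp he hx v]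
  simp only [map_sum, LinearMap.sum_apply, map_smul, LinearMap.smul_apply, smul_eq_mul]
  simp only [Finset.mul_sum, Finset.sum_mul]
  rw [Finset.sum_comm]
  refine Finset.sum_congr rfl fun b _ => Finset.sum_congr rfl fun a _ => ?_
  simp only [comp2]; ring

theorem pd_comp_symm (he : e ∈ IsManifold.maximalAtlas (𝓡 n) ∞ M) (hx : x ∈ e.target)
    {f : M → ℝ} (hf : ContMDiff (𝓡 n) 𝓘(ℝ, ℝ) ∞ f) (a : Fin n) :
    pd a (fun y => f (e.symm y)) x = mfderiv (𝓡 n) 𝓘(ℝ, ℝ) f (e.symm x) (coordVec e x a) := by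
  have hd := mdifferentiable_of_mem_maximalAtlas he
  have h := mfderiv_comp x (hf.mdifferentiableAt (x := e.symm x) (by simp))
    (hd.mdifferentiableAt_symm hx)
  rw [mfderiv_eq_fderiv] at h
  exact DFunLike.congr_fun h (EuclideanSpace.single a (1 : ℝ) : Coord n)

/-- A vector which is orthogonal to all vectors for a Lorentzian metric vanishes. -/
theorem IsLorentzianMetric.eq_zero {g : Tensor2 n M} (hg : IsLorentzianMetric g) {p : M}
    {v : TangentSpace (𝓡 n) p} (hv : ∀ u, g p u v = 0) : v = 0 := by
  obtain ⟨b, hb⟩ := hg.signature p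
  apply b.repr.injective
  ext i
  have h := hv (b i)
  rw [← b.sum_repr v] at h
  simp only [map_sum, map_smul, smul_eq_mul, hb, mul_ite, mul_zero] at h
  rw [Finset.sum_ite_eq Finset.univ i] at h
  simp only [Finset.mem_univ, if_true] at h
  split_ifs at h <;> simpa using h

/-- The components of a Lorentzian metric in a chart form a metric on the coordinate domain. -/
theorem IsLorentzianMetric.isMetricOn {g : Tensor2 n M} (hg : IsLorentzianMetric g)
    (he : e ∈ IsManifold.maximalAtlas (𝓡 n) ∞ M) : IsMetricOn (comp2 e g) e.target where
  isOpen := e.open_target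
  smooth := hg.smooth e he
  symm x _ i j := hg.symm _ _ _
  det_ne_zero x hx hdet := by
    obtain ⟨v, hv0, hv⟩ := Matrix.exists_mulVec_eq_zero_iff.2 hdet
    refine hv0 (sum_smul_coordVec_eq_zero he hx (hg.eq_zero fun u => ?_))
    rw [eq_sum_vecComp he hx u]
    simp only [map_sum, LinearMap.sum_apply, map_smul, LinearMap.smul_apply, smul_eq_mul]
    simp only [Finset.mul_sum]
    rw [Finset.sum_comm]
    refine Finset.sum_eq_zero fun a _ => ?_
    have h := congrFun hv a
    simp only [Matrix.mulVec, dotProduct, Matrix.of_apply, comp2, Pi.zero_apply] at h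
    simp_rw [mul_left_comm _ (vecComp e u a), ← Finset.mul_sum, mul_comm (v _)]
    rw [h, mul_zero]

/-- If `V` is the gradient of `Ξ`, then `g^{df} ∂_f Ξ` are its components. -/
theorem sum_invMetric_mul_pd {g : Tensor2 n M} (hg : IsLorentzianMetric g)
    (he : e ∈ IsManifold.maximalAtlas (𝓡 n) ∞ M) (hx : x ∈ e.target) {Ξ : M → ℝ}
    (hΞ : ContMDiff (𝓡 n) 𝓘(ℝ, ℝ) ∞ Ξ) {V : TangentSpace (𝓡 n) (e.symm x)}
    (hV : ∀ z, g (e.symm x) z V = mfderiv (𝓡 n) 𝓘(ℝ, ℝ) Ξ (e.symm x) z) (d : Fin n) :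
    ∑ f, invMetric (comp2 e g) x d f * pd f (fun y => Ξ (e.symm y)) x = vecComp e V d := by
  have h : ∀ f, pd f (fun y => Ξ (e.symm y)) x = ∑ c, comp2 e g x f c * vecComp e V c := by
    intro f
    rw [pd_comp_symm he hx hΞ]
    refine (hV _).symm.trans ?_
    conv_lhs => rw [eq_sum_vecComp he hx V]
    simp only [map_sum, map_smul, smul_eq_mul, comp2]
    exact Finset.sum_congr rfl fun c _ => mul_comm _ _
  simp_rw [h, Finset.mul_sum]
  rw [Finset.sum_comm]
  simp_rw [← mul_assoc, ← Finset.sum_mul, (hg.isMetricOn he).sum_invMetric_mul hx]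
  simp

theorem sum_mul_mul_mul {m : ℕ} (F : Fin m → Fin m → ℝ) (H u v w : Fin m → ℝ) :
    ∑ a, ∑ b, ∑ c, F c a * H b * u a * v b * w c
      = (∑ c, (∑ a, F c a * u a) * w c) * ∑ b, H b * v b := by
  simp_rw [Finset.sum_mul, Finset.mul_sum]
  calc _ = ∑ a, ∑ c, ∑ b, F c a * H b * u a * v b * w c :=
        Finset.sum_congr rfl fun a _ => Finset.sum_comm
    _ = ∑ c, ∑ a, ∑ b, F c a * H b * u a * v b * w c := Finset.sum_comm
    _ = _ := Finset.sum_congr rfl fun c _ => Finset.sum_congr rfl fun a _ =>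
        Finset.sum_congr rfl fun b _ => by ring

/-- Where `Ξ = 0`, the tensor `T_{abc}` is algebraic in `T_{ab}` and the gradient of `Ξ`. -/
theorem sum_rescaledCotton_of_eq_zero {g : Tensor2 n M} (hg : IsLorentzianMetric g)
    (he : e ∈ IsManifold.maximalAtlas (𝓡 n) ∞ M) {q : M} (hq : q ∈ e.source) {Ξ : M → ℝ}
    (hΞ : ContMDiff (𝓡 n) 𝓘(ℝ, ℝ) ∞ Ξ) (hΞq : Ξ q = 0) (T : Tensor2 n M)
    {V : TangentSpace (𝓡 n) q} (hV : ∀ z, g q z V = mfderiv (𝓡 n) 𝓘(ℝ, ℝ) Ξ q z)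
    (u v w : TangentSpace (𝓡 n) q) :
    ∑ a, ∑ b, ∑ c, rescaledCotton (comp2 e g) (fun y => Ξ (e.symm y)) (comp2 e T) (e q) a b c
        * vecComp e u a * vecComp e v b * vecComp e w c
      = -(1 / 2) * (g q w u * T q v V - g q w v * T q u V)
        - (3 / 2) * (T q w u * g q v V - T q w v * g q u V) := by
  obtain ⟨x, hx, rfl⟩ : ∃ x ∈ e.target, e.symm x = q := ⟨e q, e.map_source hq, e.left_inv hq⟩
  rw [e.right_inv hx]
  set P : Fin n → ℝ := fun b => pd b (fun y => Ξ (e.symm y)) x with hP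
  set S : Fin n → ℝ := fun b => ∑ d, comp2 e T x b d * vecComp e V d with hS
  have h : ∀ a b c, rescaledCotton (comp2 e g) (fun y => Ξ (e.symm y)) (comp2 e T) x a b c
        * vecComp e u a * vecComp e v b * vecComp e w c
      = -(1 / 2) * (comp2 e g x c a * S b * vecComp e u a * vecComp e v b * vecComp e w c
          - comp2 e g x c b * S a * vecComp e u a * vecComp e v b * vecComp e w c)
        - (3 / 2) * (comp2 e T x c a * P b * vecComp e u a * vecComp e v b * vecComp e w c
          - comp2 e T x c b * P a * vecComp e u a * vecComp e v b * vecComp e w c) := by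
    intro a b c
    have h1 : ∑ d, (1 / 2) * (comp2 e g x c a * comp2 e T x b d
          - comp2 e g x c b * comp2 e T x a d)
          * (∑ f, invMetric (comp2 e g) x d f * pd f (fun y => Ξ (e.symm y)) x)
        = (1 / 2) * (comp2 e g x c a * S b - comp2 e g x c b * S a) := by
      simp_rw [sum_invMetric_mul_pd hg he hx hΞ hV, hS, Finset.mul_sum, ← Finset.sum_sub_distrib,
        Finset.mul_sum]
      exact Finset.sum_congr rfl fun d _ => by ring
    rw [rescaledCotton, h1, hΞq]
    ring
  have hP' : ∀ z : TangentSpace (𝓡 n) (e.symm x),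
      ∑ b, P b * vecComp e z b = g (e.symm x) z V := by
    intro z
    have hPb : ∀ b, P b = g (e.symm x) (coordVec e x b) V :=
      fun b => (pd_comp_symm he hx hΞ b).trans (hV _).symm
    conv_rhs => rw [eq_sum_vecComp he hx z]
    simp only [map_sum, LinearMap.sum_apply, map_smul, LinearMap.smul_apply, smul_eq_mul, hPb]
    exact Finset.sum_congr rfl fun b _ => mul_comm _ _
  have hswap : ∀ F : Fin n → Fin n → ℝ, ∀ H : Fin n → ℝ,
      ∑ a, ∑ b, ∑ c, F c b * H a * vecComp e u a * vecComp e v b * vecComp e w c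
        = (∑ c, (∑ b, F c b * vecComp e v b) * vecComp e w c) * ∑ a, H a * vecComp e u a := by
    intro F H
    rw [Finset.sum_comm, ← sum_mul_mul_mul]
    exact Finset.sum_congr rfl fun b _ => Finset.sum_congr rfl fun a _ =>
      Finset.sum_congr rfl fun c _ => by ring
  simp_rw [h, Finset.sum_sub_distrib, ← Finset.mul_sum, Finset.sum_sub_distrib]
  rw [sum_mul_mul_mul, sum_mul_mul_mul, hswap, hswap, hP', hP']
  simp only [hS, sum_comp2_mul_vecComp he hx]

end Charts

section Boundary

variable {M : Type*} [TopologicalSpace M] [ChartedSpace (Coord 4) M]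
  {N : Type*} [TopologicalSpace N] [ChartedSpace (Coord 3) N]
  {g : Tensor2 4 M} {Ξ : M → ℝ} {ι : N → M} {ℓ : Tensor2 3 N}
  {nu : ∀ p : N, TangentSpace (𝓡 4) (ι p)}

namespace IsTimelikeConformalBoundary

variable (h : IsTimelikeConformalBoundary g Ξ ι ℓ nu)
include h

/-- The conformal factor is constant along the boundary. -/
theorem mfderiv_factor_tangent (p : N) (u : TangentSpace (𝓡 3) p) :
    mfderiv (𝓡 4) 𝓘(ℝ, ℝ) Ξ (ι p) (mfderiv (𝓡 3) (𝓡 4) ι p u) = 0 := by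
  have h1 := mfderiv_comp p (h.smooth_factor.mdifferentiableAt (x := ι p) (by simp))
    (h.embedding.contMDiff.mdifferentiableAt (x := p) (by simp))
  have h2 : Ξ ∘ ι = fun _ => 0 := funext h.factor_zero
  rw [h2, mfderiv_const] at h1
  exact (DFunLike.congr_fun h1 u).symm

/-- The tangent space of `M` is spanned by the tangent space of the boundary and the normal. -/
theorem exists_tangent_add_normal (p : N) (z : TangentSpace (𝓡 4) (ι p)) :
    ∃ (u : TangentSpace (𝓡 3) p) (c : ℝ), z = mfderiv (𝓡 3) (𝓡 4) ι p u + c • nu p := by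
  -- an injective linear map between spaces of dimension `3 + 1` and `4` is surjective
  let L : (Coord 3 × ℝ) →ₗ[ℝ] Coord 4 :=
    (mfderiv (𝓡 3) (𝓡 4) ι p : Coord 3 →L[ℝ] Coord 4).toLinearMap.coprod
      (LinearMap.toSpanSingleton ℝ (Coord 4) (nu p))
  -- pairing with the normal gives `c = 0`, and then `u` is orthogonal to everything for `ℓ`
  have key : ∀ (u : TangentSpace (𝓡 3) p) (c : ℝ),
      mfderiv (𝓡 3) (𝓡 4) ι p u + c • nu p = 0 → u = 0 ∧ c = 0 := by
    intro u c hw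
    have h1 := congrArg (g (ι p) (nu p)) hw
    rw [map_add, map_smul, h.normal_unit, h.normal_orthogonal, map_zero] at h1
    have hc : c = 0 := by simpa using h1
    rw [hc, zero_smul, add_zero] at hw
    refine ⟨h.lorentz_induced.eq_zero fun v => ?_, hc⟩
    rw [h.induced, hw, map_zero]
  have hinj : Function.Injective L := by
    rw [injective_iff_map_eq_zero]
    intro w hw
    exact Prod.ext (key w.1 w.2 hw).1 (key w.1 w.2 hw).2
  have hsurj := (LinearMap.injective_iff_surjective_of_finrank_eq_finrank (by simp)).1 hinj
  obtain ⟨w, hw⟩ := hsurj z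
  exact ⟨w.1, w.2, hw.symm⟩

/-- On the boundary, the gradient of the conformal factor is `Σ n^a`. -/
theorem gradient_factor (p : N) (z : TangentSpace (𝓡 4) (ι p)) :
    g (ι p) z (normalDeriv Ξ ι nu p • nu p) = mfderiv (𝓡 4) 𝓘(ℝ, ℝ) Ξ (ι p) z := by
  obtain ⟨u, c, rfl⟩ := h.exists_tangent_add_normal p z
  rw [map_smul, h.lorentz.symm, map_add, map_smul, h.normal_unit, h.normal_orthogonal]
  have e1 : mfderiv (𝓡 4) 𝓘(ℝ, ℝ) Ξ (ι p) (mfderiv (𝓡 3) (𝓡 4) ι p u + c • nu p)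
      = c * normalDeriv Ξ ι nu p :=
    (map_add (mfderiv (𝓡 4) 𝓘(ℝ, ℝ) Ξ (ι p)) _ _).trans ((congrArg₂ (fun a b : ℝ => a + b)
      (h.mfderiv_factor_tangent p u)
      (map_smul (mfderiv (𝓡 4) 𝓘(ℝ, ℝ) Ξ (ι p)) c (nu p))).trans (zero_add _))
  refine Eq.trans ?_ e1.symm
  simp [mul_comm]

/-- `T_{abc}` on the boundary, with the gradient of `Ξ` replaced by `Σ n^a`. -/
theorem rescaledCottonAt_eq [IsManifold (𝓡 4) ∞ M] (T : Tensor2 4 M) (p : N)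
    (u v w : TangentSpace (𝓡 4) (ι p)) :
    rescaledCottonAt g Ξ T (ι p) u v w = normalDeriv Ξ ι nu p *
      (-(1 / 2) * (g (ι p) w u * T (ι p) v (nu p) - g (ι p) w v * T (ι p) u (nu p))
        - (3 / 2) * (T (ι p) w u * g (ι p) v (nu p) - T (ι p) w v * g (ι p) u (nu p))) := by
  rw [rescaledCottonAt, sum_rescaledCotton_of_eq_zero h.lorentz
    (IsManifold.chart_mem_maximalAtlas (ι p)) (mem_chart_source _ _) h.smooth_factor
    (h.factor_zero p) T (h.gradient_factor p)]
  simp only [map_smul, smul_eq_mul]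
  ring

/-- `J_i = -Σ j_i`: the two algebraic terms of `T_{abc}` contribute `½ Σ j_i` and `-(3/2) Σ j_i`. -/
theorem J1Field_eq [IsManifold (𝓡 4) ∞ M] {T : Tensor2 4 M} (hT : SymmTensor2 T)
    (e : OpenPartialHomeomorph N (Coord 3)) (x : Coord 3) (i : Fin 3) :
    J1Field g Ξ T ι nu e x i
      = -(normalDeriv Ξ ι nu (e.symm x) * jField T ι nu e x i) := by
  rw [J1Field, h.rescaledCottonAt_eq, h.normal_unit,
    h.lorentz.symm _ (pushVec ι e x i) (nu _), pushVec, h.normal_orthogonal, jField, pushVec,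
    hT _ (nu _) (mfderiv (𝓡 3) (𝓡 4) ι (e.symm x) (coordVec e x i))]
  ring

/-- `J_{ij} = 0`: every term contains a scalar product of the normal with a tangential vector. -/
theorem J2Field_eq_zero [IsManifold (𝓡 4) ∞ M] (T : Tensor2 4 M)
    (e : OpenPartialHomeomorph N (Coord 3)) (x : Coord 3) (i j : Fin 3) :
    J2Field g Ξ T ι nu e x i j = 0 := by
  rw [J2Field, h.rescaledCottonAt_eq, h.lorentz.symm _ (pushVec ι e x i) (nu _),
    h.lorentz.symm _ (pushVec ι e x j) (nu _), pushVec, pushVec, h.normal_orthogonal,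
    h.normal_orthogonal]
  ring

end IsTimelikeConformalBoundary
end Boundary

/-! ### The constraints for the explicit fields -/

section Dim3

namespace IsMetricOn

variable {U : Set (Coord 3)} {g : Coord 3 → Fin 3 → Fin 3 → ℝ} {x : Coord 3}
  (hg : IsMetricOn g U)
include hg

theorem raise_smul_metric (hx : x ∈ U) (κ : Coord 3 → ℝ) (i k : Fin 3) :
    raise g (fun y i j => κ y * g y i j) x i k = if k = i then κ x else 0 := by
  have h := hg.sum_invMetric_mul hx k i
  simp only [raise, mul_left_comm _ (κ x), ← Finset.mul_sum, hg.symm x hx i, h]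
  simp

theorem sum_raise_smul_metric_mul (hx : x ∈ U) (κ : Coord 3 → ℝ) (i : Fin 3) (v : Fin 3 → ℝ) :
    ∑ k, raise g (fun y i j => κ y * g y i j) x i k * v k = κ x * v i := by
  simp [hg.raise_smul_metric hx]

theorem raise2_smul_metric (hx : x ∈ U) (κ : Coord 3 → ℝ) (i j : Fin 3) :
    raise2 g (fun y i j => κ y * g y i j) x i j = κ x * invMetric g x i j := by
  have h : ∀ a b, invMetric g x i a * invMetric g x j b * (κ x * g x a b)
      = κ x * invMetric g x i a * (g x a b * invMetric g x b j) := by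
    intro a b
    rw [hg.invMetric_symm hx j b]; ring
  simp only [raise2, h, ← Finset.mul_sum, hg.sum_mul_invMetric hx]
  simp

theorem trace2_smul_metric (hx : x ∈ U) (κ : Coord 3 → ℝ) :
    trace2 g (fun y i j => κ y * g y i j) x = 3 * κ x := by
  simp only [trace2, mul_left_comm _ (κ x), ← Finset.mul_sum]
  have : ∀ i, ∑ j, invMetric g x i j * g x i j = 1 := by
    intro i
    simp_rw [hg.symm x hx i, hg.sum_invMetric_mul hx]
    simp
  simp only [this]
  simp [mul_comm]

theorem sum_smul_metric_mul_raise2 (hx : x ∈ U) (κ : Coord 3 → ℝ) :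
    ∑ k, ∑ l, κ x * g x k l * raise2 g (fun y i j => κ y * g y i j) x k l = 3 * κ x ^ 2 := by
  have h := hg.trace2_smul_metric hx κ
  simp only [hg.raise2_smul_metric hx, pow_two]
  rw [← mul_assoc, ← h, trace2, Finset.sum_mul]
  refine Finset.sum_congr rfl fun k _ => ?_
  rw [Finset.sum_mul]
  exact Finset.sum_congr rfl fun l _ => by ring

/-- The covariant derivative of `L_{ij} = l_{ij} - ½ κ² ℓ_{ij}`. -/
theorem cov2_shifted_schouten3 {κ : Coord 3 → ℝ} (hκ : ContDiffOn ℝ ∞ κ U) (hx : x ∈ U)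
    (k i j : Fin 3) :
    cov2 g (fun y i j => schouten3 g y i j - (1 / 2) * κ y ^ 2 * g y i j) x k i j
      = cov2 g (schouten3 g) x k i j - κ x * pd k κ x * g x i j := by
  have hκ2 : ContDiffOn ℝ ∞ (fun y => (1 / 2) * κ y ^ 2) U := contDiffOn_const.mul (hκ.pow 2)
  have hd := differentiableAt_of_smooth hg.isOpen hκ hx
  have hp : pd k (fun y => (1 / 2) * κ y ^ 2) x = κ x * pd k κ x := by
    simp_rw [pow_two]
    rw [pd_const_mul (f := fun y => κ y * κ y) k (1 / 2) (hd.mul hd), pd_mul k hd hd]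
    ring
  rw [hg.cov2_sub hg.smooth_schouten3 (fun i j => hκ2.mul (hg.smooth i j)) hx,
    hg.cov2_mul_metric hκ2 hx, hp]

/-- The divergence of `d_{kij} = -Σ⁻¹ y_{ijk}` vanishes. -/
theorem div_dMag (hx : x ∈ U) (c : ℝ) (i j : Fin 3) :
    ∑ k, ∑ m, invMetric g x k m
      * cov3 g (fun y k i j => -(c * cotton3 g y i j k)) x m k i j = 0 := by
  have hS := hg.smooth_schouten3
  have h : ∀ k m, invMetric g x k m * cov3 g (fun y k i j => -(c * cotton3 g y i j k)) x m k i j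
      = -c * (invMetric g x k m * cov3 g (cov2 g (schouten3 g)) x m i j k
        - invMetric g x k m * cov3 g (cov2 g (schouten3 g)) x m j i k) := by
    intro k m
    have d1 := differentiableAt_of_smooth hg.isOpen (hg.smooth_cov2 hS i j k) hx
    have d2 := differentiableAt_of_smooth hg.isOpen (hg.smooth_cov2 hS j i k) hx
    have hp : pd m (fun y => -(c * cotton3 g y i j k)) x
        = -(c * (pd m (fun y => cov2 g (schouten3 g) y i j k) x
          - pd m (fun y => cov2 g (schouten3 g) y j i k) x)) := by
      rw [pd_neg, ← pd_sub m d1 d2]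
      exact congrArg (- ·) (pd_const_mul m c (d1.sub d2))
    rw [cov3, hp]
    simp only [cov3, cotton3, mul_neg, mul_sub, Finset.sum_neg_distrib,
      Finset.sum_sub_distrib, mul_left_comm _ c, ← Finset.mul_sum]
    ring
  simp_rw [h, ← Finset.mul_sum, Finset.sum_sub_distrib]
  rw [hg.div_cotton3 hx, sub_self, mul_zero]

/-- The term `K^{jk} d_{jik}` vanishes, as it is a multiple of a trace of the Cotton tensor. -/
theorem sum_raise2_smul_metric_mul_dMag (hx : x ∈ U) (κ : Coord 3 → ℝ) (c : ℝ) (i : Fin 3) :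
    ∑ j, ∑ k, raise2 g (fun y i j => κ y * g y i j) x j k * -(c * cotton3 g x i k j) = 0 := by
  have h : ∀ j k, raise2 g (fun y i j => κ y * g y i j) x j k * -(c * cotton3 g x i k j)
      = -(κ x * c) * (invMetric g x j k * cotton3 g x i k j) := by
    intro j k
    rw [hg.raise2_smul_metric hx]; ring
  simp_rw [h, ← Finset.mul_sum]
  rw [hg.trace_cotton3 hx, mul_zero]

end IsMetricOn

/-- For vanishing `J_{ij}`, all the constraints on the explicit fields are identities, except for
the one on the divergence of `d_{ij}`. -/
theorem solvesConstraintsOn_explicitFields_iff {U : Set (Coord 3)} {lam : ℝ} (hlam : lam < 0)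
    {ℓ : Coord 3 → Fin 3 → Fin 3 → ℝ} (hℓ : IsMetricOn ℓ U) {J1 : Coord 3 → Fin 3 → ℝ}
    {J2 : Coord 3 → Fin 3 → Fin 3 → ℝ} (hJ2 : ∀ x ∈ U, ∀ i j, J2 x i j = 0)
    {κ : Coord 3 → ℝ} (hκ : ContDiffOn ℝ ∞ κ U) {d : Coord 3 → Fin 3 → Fin 3 → ℝ}
    (hd : ∀ x ∈ U, ∀ i j, d x i j = d x j i) (hd_trace : ∀ x ∈ U, trace2 ℓ d x = 0) :
    SolvesConstraintsOn lam ℓ J1 J2 (explicitFields lam ℓ κ d) U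
      ↔ ∀ x ∈ U, ∀ i, div2 ℓ d x i = J1 x i := by
  have hσ : 0 < √(|lam| / 3) := Real.sqrt_pos.2 (by have := abs_pos.2 hlam.ne; positivity)
  refine ⟨fun h x hx i => ?_, fun h => ?_⟩
  · have := h.eq7 x hx i
    simp only [explicitFields] at this
    rwa [hℓ.sum_raise2_smul_metric_mul_dMag hx, zero_add] at this
  refine
    { K_symm := fun x hx i j => ?_
      L2_symm := fun x hx i j => ?_
      dEl_symm := hd
      dEl_trace := hd_trace
      dMag_antisymm := fun x hx k i j => ?_
      dMag_cyclic := fun x hx k i j => ?_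
      eq1 := fun x hx i j => ?_
      eq2 := fun x hx i => ?_
      eq3 := fun x hx i => ?_
      eq4 := fun x hx i j k => ?_
      eq5 := fun x hx i j => ?_
      eq6 := fun x hx i j => ?_
      eq7 := fun x hx i => ?_
      eq8 := fun x hx => ?_
      eq9 := fun x hx i j k => ?_
      eq10 := fun x hx i j => ?_ }
  all_goals simp only [explicitFields]
  · rw [hℓ.symm x hx]
  · rw [hℓ.symm x hx, hℓ.schouten3_symm hx]
  · simp only [cotton3]; ring
  · linear_combination -(√(|lam| / 3))⁻¹ * hℓ.cotton3_cyclic hx i j k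
  · ring
  · exact pd_const i _
  · rw [pd_const_mul i _ (differentiableAt_of_smooth hℓ.isOpen hκ hx)]; ring
  · rw [hℓ.cov2_shifted_schouten3 hκ hx, hℓ.cov2_shifted_schouten3 hκ hx, mul_neg, neg_neg,
      mul_inv_cancel_left₀ hσ.ne', cotton3]
    ring
  · have h1 := hℓ.cov1_pd_symm hκ hx i j
    rw [hℓ.sum_raise_smul_metric_mul hx, hℓ.sum_raise_smul_metric_mul hx, hℓ.symm x hx i j,
      hℓ.schouten3_symm hx i j]
    simp only [cov1, pd_neg, mul_neg, Finset.sum_neg_distrib] at h1 ⊢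
    linarith
  · rw [hℓ.div_dMag hx, hℓ.sum_raise_smul_metric_mul hx, hℓ.sum_raise_smul_metric_mul hx,
      hJ2 x hx, hd x hx i j]
    ring
  · rw [hℓ.sum_raise2_smul_metric_mul_dMag hx, zero_add, h x hx]
  · rw [Real.sq_sqrt (by positivity), abs_of_neg hlam]; ring
  · rw [hℓ.cov2_mul_metric hκ hx, hℓ.cov2_mul_metric hκ hx, hℓ.symm x hx k i, hℓ.symm x hx j i]
    ring
  · have h1 := hℓ.sum_raise_smul_metric_mul hx κ j fun k => κ x * ℓ x k i
    simp_rw [mul_comm (raise _ _ _ _ _)] at h1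
    rw [h1, hℓ.trace2_smul_metric hx, hℓ.sum_smul_metric_mul_raise2 hx, hℓ.symm x hx j i]
    ring

end Dim3

end ConformalBoundary

end

theorem mainTheorem3
    {M : Type*} [TopologicalSpace M] [ChartedSpace (ConformalBoundary.Coord 4) M]
    [IsManifold (𝓡 4) ∞ M]
    {N : Type*} [TopologicalSpace N] [ChartedSpace (ConformalBoundary.Coord 3) N]
    [IsManifold (𝓡 3) ∞ N]
    (lam : ℝ) (hlam : lam < 0)
    (g : ConformalBoundary.Tensor2 4 M) (Ξ : M → ℝ)
    (ι : N → M) (ℓ : ConformalBoundary.Tensor2 3 N)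
    (nu : ∀ p : N, TangentSpace (𝓡 4) (ι p))
    (hscri : ConformalBoundary.IsTimelikeConformalBoundary g Ξ ι ℓ nu)
    (hsigma : ∀ p, ConformalBoundary.normalDeriv Ξ ι nu p = √(|lam| / 3))
    (T : ConformalBoundary.Tensor2 4 M)
    (hT_smooth : ConformalBoundary.SmoothTensor2 T) (hT_symm : ConformalBoundary.SymmTensor2 T)
    (hT_trace : ConformalBoundary.TracefreeTensor2 g T)
    (κ : N → ℝ) (hκ : ContMDiff (𝓡 3) 𝓘(ℝ, ℝ) ∞ κ)
    (d : ConformalBoundary.Tensor2 3 N)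
    (hd_smooth : ConformalBoundary.SmoothTensor2 d) (hd_symm : ConformalBoundary.SymmTensor2 d)
    (hd_trace : ConformalBoundary.TracefreeTensor2 ℓ d)
    (e : OpenPartialHomeomorph N (ConformalBoundary.Coord 3))
    (he : e ∈ IsManifold.maximalAtlas (𝓡 3) ∞ N) :
    ConformalBoundary.SolvesConstraintsOn lam (ConformalBoundary.comp2 e ℓ)
        (ConformalBoundary.J1Field g Ξ T ι nu e) (ConformalBoundary.J2Field g Ξ T ι nu e)
        (ConformalBoundary.explicitFields lam (ConformalBoundary.comp2 e ℓ)
          (fun x => κ (e.symm x)) (ConformalBoundary.comp2 e d)) e.target ↔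
      ∀ x ∈ e.target, ∀ i, ConformalBoundary.div2 (ConformalBoundary.comp2 e ℓ)
        (ConformalBoundary.comp2 e d) x i
          = -(√(|lam| / 3) * ConformalBoundary.jField T ι nu e x i) := by
  have hJ : ∀ x i, ConformalBoundary.J1Field g Ξ T ι nu e x i
      = -(√(|lam| / 3) * ConformalBoundary.jField T ι nu e x i) := fun x i => by
    rw [hscri.J1Field_eq hT_symm e x i, hsigma (e.symm x)]
  have hd : ∀ x ∈ e.target, ∀ i j, ConformalBoundary.comp2 e d x i j
      = ConformalBoundary.comp2 e d x j i := fun x _ i j =>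
    hd_symm (e.symm x) (ConformalBoundary.coordVec e x i) (ConformalBoundary.coordVec e x j)
  refine (ConformalBoundary.solvesConstraintsOn_explicitFields_iff hlam
    (hscri.lorentz_induced.isMetricOn he) (fun x _ i j => hscri.J2Field_eq_zero T e x i j)
    (ConformalBoundary.contDiffOn_comp_symm he hκ) hd (hd_trace e he)).trans ?_
  simp only [hJ]
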